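/- Let $h\in\mathbb C$ and let $j_1,j_2\in\{0,\tfrac12,1,\tfrac32,\dots\}$ be arbitrary spins. Use the basis $|jm\rangle$, $m=j,j-1,\dots,-j$. **Standard side.** For $q\in\mathbb C$ near $1$, $q\neq1$, put $[n]_q=\frac{q^n-q^{-n}}{q-q^{-1}}$, $\{n\}_q=\frac{1-q^n}{1-q}$, $[n]_q!=[n]_q\cdots[1]_q$, $\{n\}_q!=\{n\}_q\cdots\{1\}_q$ (with $[0]_q!=\{0\}_q!=1$), $\mathrm E_q(A)=\sum_{n\ge0}A^n/[n]_q!$ and $\exp_q(A)=\sum_{n\ge0}A^n/\{n\}_q!$. In the spin-$j$ representation of $\mathrm U_q(\mathrm{sl}(2))$ given by $$\hat J_+|jm\rangle=[j-m]_q[j+m+1]_q\,|j\,m{+}1\rangle,\qquad \hat J_-|jm\rangle=|j\,m{-}1\rangle,\qquad \hat J_0|jm\rangle=2m\,|jm\rangle,$$ let $R_q^{j_1;j_2}$ be the value in the representation $j_1\otimes j_2$ of $$\mathcal R_q=q^{\frac12\hat J_0\otimes\hat J_0}\exp_{q^{-2}}\!\left((1-q^{-2})\,q^{\hat J_0/2}\hat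 J_+\otimes q^{-\hat J_0/2}\hat J_-\right)$$ (powers of $q$ with the principal logarithm), and let $M_j$ be the value of $\mathrm E_q(\eta\hat J_+)$, $\eta=h/(q-1)$, in the spin-$j$ representation. **Jordanian side.** In the spin-$j$ representation of $\mathrm U(\mathrm{sl}(2))$ given by $J_+|jm\rangle=(j-m)(j+m+1)|j\,m{+}1\rangle$, $J_-|jm\rangle=|j\,m{-}1\rangle$, $J_0|jm\rangle=2m|jm\rangle$, put $$\tilde T=hJ_++\left(1+(hJ_+)^2\right)^{1/2},\qquad H=\left(1+(hJ_+)^2\right)^{1/2}J_0,\qquad X=h^{-1}\operatorname{arcsinh}(hJ_+)=\sum_{k\ge0}\frac{(-1)^k\binom{2k}{k}}{4^k(2k+1)}h^{2k}J_+^{2k+1},$$ where the square root is the binomial series (all series are finite, since $J_+$ is nilpotent), and $T=\exp(hX)$. Let $R_h^{j_1;j_2}$ be the value, with these matrices, of $$\mathcal R_h=\exp(-hX\otimes TH)\exp(hTH\otimes X).$$ **Claim.** In the spins $j_1$ and $j_2$ one has $T=\tilde T$; moreover the limit $$\tilde R_h^{j_1;j_2}=\lim_{q\to1,\ q\ne1}\left[\left(M_{j_1}^{-1}\otimes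 M_{j_2}^{-1}\right)R_q^{j_1;j_2}\left(M_{j_1}\otimes M_{j_2}\right)\right]$$ exists (the singularities at $q=1$ cancel), is an invertible matrix, and equals $R_h^{j_1;j_2}$. -/

import Mathlib

open Filter Topology
open scoped Kronecker

noncomputable section

namespace Contraction

/-! ## `q`-numbers and functions of a matrix -/

/-- The symmetric `q`-number `[n]_q = (q ^ n - q ^ (-n)) / (q - q ^ (-1))`. -/
def symNum (q : ℂ) (n : ℕ) : ℂ := (q ^ n - (q ^ n)⁻¹) / (q - q⁻¹)

/-- `[n]_q! = [n]_q ⋯ [1]_q`, with `[0]_q! = 1`. -/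
def symFactorial (q : ℂ) (n : ℕ) : ℂ := ∏ k ∈ Finset.range n, symNum q (k + 1)

/-- The asymmetric `q`-number `{n}_q = (1 - q ^ n) / (1 - q)`. -/
def asymNum (q : ℂ) (n : ℕ) : ℂ := (1 - q ^ n) / (1 - q)

/-- `{n}_q! = {n}_q ⋯ {1}_q`, with `{0}_q! = 1`. -/
def asymFactorial (q : ℂ) (n : ℕ) : ℂ := ∏ k ∈ Finset.range n, asymNum q (k + 1)

section Functions

variable {ι : Type*} [Fintype ι] [DecidableEq ι]

/-- `E_q(A) = ∑ Aⁿ / [n]_q!`. Below it is only applied to nilpotent matrices, so the sum has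
finite support. -/
def symExp (q : ℂ) (A : Matrix ι ι ℂ) : Matrix ι ι ℂ := ∑' n : ℕ, (symFactorial q n)⁻¹ • A ^ n

/-- `exp_q(A) = ∑ Aⁿ / {n}_q!`. Below it is only applied to nilpotent matrices. -/
def asymExp (q : ℂ) (A : Matrix ι ι ℂ) : Matrix ι ι ℂ := ∑' n : ℕ, (asymFactorial q n)⁻¹ • A ^ n

/-- `q ^ A = exp (log q · A)`, with the principal logarithm. -/
def qPow (q : ℂ) (A : Matrix ι ι ℂ) : Matrix ι ι ℂ := NormedSpace.exp (Complex.log q • A)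

/-- `(1 + A) ^ (1/2)` for a nilpotent matrix `A`, by the binomial series. -/
def sqrtOneAdd (A : Matrix ι ι ℂ) : Matrix ι ι ℂ := ∑' k : ℕ, Ring.choose (1 / 2 : ℂ) k • A ^ k

end Functions

/-! ## Spin representations

The spin is `j = N / 2` with `N : ℕ`. The `N + 1` basis vectors `|j m⟩` are listed in the order
`m = j, j - 1, …, -j`, so the index `i : Fin (N + 1)` stands for `m = N / 2 - i`; then
`j - m = i` and `j + m + 1 = N + 1 - i`. -/

/-- The weight matrix `J₀ |j m⟩ = 2 m |j m⟩`, for both the classical and the `q`-deformed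
algebra. -/
def J0 (N : ℕ) : Matrix (Fin (N + 1)) (Fin (N + 1)) ℂ :=
  Matrix.diagonal fun i => (N : ℂ) - 2 * ((i : ℕ) : ℂ)

/-- The lowering matrix `J₋ |j m⟩ = |j (m - 1)⟩`, for both the classical and the `q`-deformed
algebra. -/
def Jminus (N : ℕ) : Matrix (Fin (N + 1)) (Fin (N + 1)) ℂ :=
  Matrix.of fun r c => if (r : ℕ) = (c : ℕ) + 1 then 1 else 0

/-- The raising matrix of U_q(sl(2)): `J₊ |j m⟩ = [j - m]_q [j + m + 1]_q |j (m + 1)⟩`. -/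
def qJplus (q : ℂ) (N : ℕ) : Matrix (Fin (N + 1)) (Fin (N + 1)) ℂ :=
  Matrix.of fun r c =>
    if (r : ℕ) + 1 = (c : ℕ) then symNum q (c : ℕ) * symNum q (N + 1 - (c : ℕ)) else 0

/-- The classical raising matrix: `J₊ |j m⟩ = (j - m) (j + m + 1) |j (m + 1)⟩`. -/
def Jplus (N : ℕ) : Matrix (Fin (N + 1)) (Fin (N + 1)) ℂ :=
  Matrix.of fun r c =>
    if (r : ℕ) + 1 = (c : ℕ) then ((c : ℕ) : ℂ) * ((N + 1 - (c : ℕ) : ℕ) : ℂ) else 0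

/-! ## The standard side -/

/-- The universal `R` matrix of U_q(sl(2)),
`q ^ (½ J₀ ⊗ J₀) exp_{q⁻²} ((1 - q⁻²) q ^ (J₀ / 2) J₊ ⊗ q ^ (-J₀ / 2) J₋)`,
in the representation with spins `N₁ / 2` and `N₂ / 2`. -/
def Rq (q : ℂ) (N₁ N₂ : ℕ) :
    Matrix (Fin (N₁ + 1) × Fin (N₂ + 1)) (Fin (N₁ + 1) × Fin (N₂ + 1)) ℂ :=
  qPow q ((1 / 2 : ℂ) • (J0 N₁ ⊗ₖ J0 N₂)) *
    asymExp ((q ^ 2)⁻¹)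
      ((1 - (q ^ 2)⁻¹) •
        ((qPow q ((1 / 2 : ℂ) • J0 N₁) * qJplus q N₁) ⊗ₖ
          (qPow q (-((1 / 2 : ℂ) • J0 N₂)) * Jminus N₂)))

/-- The transforming matrix `M = E_q (η J₊)` with `η = h / (q - 1)`, at spin `N / 2`. -/
def M (h q : ℂ) (N : ℕ) : Matrix (Fin (N + 1)) (Fin (N + 1)) ℂ :=
  symExp q ((h / (q - 1)) • qJplus q N)

/-! ## The Jordanian side, through the nonlinear map -/

/-- `T̃ = h J₊ + (1 + (h J₊)²) ^ (1/2)` at spin `N / 2`. -/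
def Ttilde (h : ℂ) (N : ℕ) : Matrix (Fin (N + 1)) (Fin (N + 1)) ℂ :=
  h • Jplus N + sqrtOneAdd ((h • Jplus N) ^ 2)

/-- `X = h⁻¹ arcsinh (h J₊)`, which is the matrix `X` with `exp (h X) = T̃`, through the series
`X = ∑ (-1)ᵏ C(2k, k) / (4ᵏ (2k + 1)) h²ᵏ J₊²ᵏ⁺¹`, which makes sense for `h = 0` too (`X = J₊`). -/
def X (h : ℂ) (N : ℕ) : Matrix (Fin (N + 1)) (Fin (N + 1)) ℂ :=
  ∑' k : ℕ, ((-1) ^ k * (Nat.centralBinom k : ℂ) / (4 ^ k * (2 * (k : ℂ) + 1)) * h ^ (2 * k)) •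
    Jplus N ^ (2 * k + 1)

/-- `H = (1 + (h J₊)²) ^ (1/2) J₀` at spin `N / 2`. -/
def H (h : ℂ) (N : ℕ) : Matrix (Fin (N + 1)) (Fin (N + 1)) ℂ :=
  sqrtOneAdd ((h • Jplus N) ^ 2) * J0 N

/-- `T = exp (h X)` at spin `N / 2`. -/
def T (h : ℂ) (N : ℕ) : Matrix (Fin (N + 1)) (Fin (N + 1)) ℂ :=
  NormedSpace.exp (h • X h N)

/-- The universal `R` matrix of U_h(sl(2)), `exp (-h X ⊗ T H) exp (h T H ⊗ X)`, in the
representation with spins `N₁ / 2` and `N₂ / 2`. -/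
def Rh (h : ℂ) (N₁ N₂ : ℕ) :
    Matrix (Fin (N₁ + 1) × Fin (N₂ + 1)) (Fin (N₁ + 1) × Fin (N₂ + 1)) ℂ :=
  NormedSpace.exp (-(h • (X h N₁ ⊗ₖ (T h N₂ * H h N₂)))) *
    NormedSpace.exp (h • ((T h N₁ * H h N₁) ⊗ₖ X h N₂))

end Contraction

end

noncomputable section

namespace Contraction

/-! ### Exponentials and power series of nilpotent matrices -/

section Nilpotent

variable {ι : Type*} [Fintype ι] [DecidableEq ι]

/-! Both `R` matrices are quotients of two twists, and the twists converge. Write Δ for the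
coproduct of `J₊` and Δ' for the opposite one. Since R_q Δ = Δ' R_q (`Rq_mul_coproduct`), R_q also
intertwines the `q`-exponentials E_q(ηΔ) and E_q(ηΔ'). With F_q(1) = (M ⊗ M)⁻¹ E_q(ηΔ) and F_q(-1) =
(M ⊗ M)⁻¹ E_q(ηΔ'), the conjugated `R` matrix R̃ satisfies R̃ F_q(1) = F_q(-1) R_q
(`conj_Rq_mul_qTwist`). The unconjugated R_q tends to 1, so only the limits of F_q(±1) matter.

By a `q`-binomial theorem, E_q(ηΔ) acts on a vector of weights (w₁, w₂) as a product of two one-leg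
`q`-exponentials, dilated by q^(w₂/2) and q^(-w₁/2) (`sum_coproductDivPow`). Everything thus reduces
to M⁻¹ E_q(η q^a J₊), that is, to powers of M⁻¹ q^(J₀/4) M. Although η diverges, the quotient t(x) =
E_q(ηqx)/E_q(ηx) obeys the Riccati equation t(x) t(x/q) = 1 + (q - q⁻¹)η x t(x/q), whose coefficient
tends to 2h; its power series coefficients therefore converge recursively. The limit V of M⁻¹
q^(J₀/4) M satisfies V² - V⁻² = 2hJ₊ = T - T⁻¹, and unipotence forces V = T^(1/2)
(`tendsto_conjWeight`). Hence F_q(±1) tends to the matrix `jordanTwist` with `s` = ±1, which is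
invertible because it is unitriangular.

It remains to check that `Rh` carries the first limit twist to the second (`Rh_mul_jordanTwist`).
With x = hX and d = TH on each leg, exp(d₁x₂) conjugates e^(-2(x₁+x₂)) to e^(-2x₁) + e^(-2x₂) - 1.
This is symmetric in the legs, so exp(d₂x₁) gives the same conjugate. Moreover T^(-w/2)|w⟩ is an
eigenvector of TH with eigenvalue w. Together these facts give exp(d₁x₂) F(1) = exp(d₂x₁) F(-1).

The equality T = T̃ follows from a logarithmic derivative argument in which ad J₀ plays the role of
2x d/dx on series in x = J₊ (`Tpow_one`). -/

theorem tsum_smul_pow_eq_sum (a : ℕ → ℂ) {A : Matrix ι ι ℂ} {n : ℕ} (hA : A ^ n = 0) :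
    ∑' k, a k • A ^ k = ∑ k ∈ Finset.range n, a k • A ^ k := by
  refine tsum_eq_sum fun k hk => ?_
  rw [pow_eq_zero_of_le (by simpa using hk) hA, smul_zero]

theorem exp_eq_sum_range {A : Matrix ι ι ℂ} {n : ℕ} (hA : A ^ n = 0) :
    NormedSpace.exp A = ∑ k ∈ Finset.range n, ((k.factorial : ℂ)⁻¹) • A ^ k := by
  rw [NormedSpace.exp_eq_tsum ℂ]
  exact tsum_smul_pow_eq_sum _ hA

theorem exp_mul_of_mul_eq {A B C : Matrix ι ι ℂ} (h : A * C = C * B) (hA : IsNilpotent A)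
    (hB : IsNilpotent B) : NormedSpace.exp A * C = C * NormedSpace.exp B := by
  obtain ⟨m, hm⟩ := hA
  obtain ⟨n, hn⟩ := hB
  rw [exp_eq_sum_range (pow_eq_zero_of_le (le_max_left m n) hm),
    exp_eq_sum_range (pow_eq_zero_of_le (le_max_right m n) hn), Finset.sum_mul, Finset.mul_sum]
  refine Finset.sum_congr rfl fun k _ => ?_
  have : SemiconjBy C B A := h.symm
  rw [smul_mul_assoc, mul_smul_comm, (this.pow_right k).eq]

/-- Commutation allows the factors to be exchanged one at a time: AᵏAC = AᵏBC = BAᵏC. It serves to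
replace an operator by its eigenvalue on an eigenvector. -/
theorem exp_mul_congr {A B C : Matrix ι ι ℂ} (h : A * C = B * C) (hAB : Commute A B)
    (hA : IsNilpotent A) (hB : IsNilpotent B) :
    NormedSpace.exp A * C = NormedSpace.exp B * C := by
  obtain ⟨m, hm⟩ := hA
  obtain ⟨n, hn⟩ := hB
  rw [exp_eq_sum_range (pow_eq_zero_of_le (le_max_left m n) hm),
    exp_eq_sum_range (pow_eq_zero_of_le (le_max_right m n) hn), Finset.sum_mul, Finset.sum_mul]
  refine Finset.sum_congr rfl fun k hk => ?_
  clear hk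
  rw [smul_mul_assoc, smul_mul_assoc]
  congr 1
  induction k with
  | zero => simp
  | succ k ih =>
    rw [pow_succ, mul_assoc, h, ← mul_assoc, (hAB.pow_left k).eq, mul_assoc, ih, ← mul_assoc,
      pow_succ']

theorem mul_pow_of_commutator {D Y Δ : Matrix ι ι ℂ} (h : D * Y = Y * D + Δ) (hΔ : Commute Δ Y)
    (n : ℕ) : D * Y ^ (n + 1) = Y ^ (n + 1) * D + ((n : ℂ) + 1) • (Y ^ n * Δ) := by
  induction n with
  | zero => simpa using h
  | succ n ih =>
    rw [pow_succ Y (n + 1), ← mul_assoc, ih, add_mul, mul_assoc, h, smul_mul_assoc, mul_assoc,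
      hΔ.eq, ← mul_assoc (Y ^ n), ← pow_succ, mul_add, ← mul_assoc]
    push_cast
    module

theorem mul_exp_of_commutator {D Y Δ : Matrix ι ι ℂ} (h : D * Y = Y * D + Δ) (hΔ : Commute Δ Y)
    (hY : IsNilpotent Y) :
    D * NormedSpace.exp Y = NormedSpace.exp Y * D + NormedSpace.exp Y * Δ := by
  obtain ⟨n, hn⟩ := hY
  have hn' : Y ^ (n + 1) = 0 := by rw [pow_succ, hn, zero_mul]
  have key : D * ∑ k ∈ Finset.range (n + 1), ((k.factorial : ℂ)⁻¹) • Y ^ k =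
      (∑ k ∈ Finset.range (n + 1), ((k.factorial : ℂ)⁻¹) • Y ^ k) * D +
      (∑ k ∈ Finset.range n, ((k.factorial : ℂ)⁻¹) • Y ^ k) * Δ := by
    rw [Finset.sum_range_succ', mul_add, add_mul, Finset.mul_sum, Finset.sum_mul, Finset.sum_mul]
    simp only [pow_zero, Nat.factorial_zero, Nat.cast_one, inv_one, one_smul, mul_one, one_mul]
    rw [add_right_comm, ← Finset.sum_add_distrib]
    congr 1
    refine Finset.sum_congr rfl fun k _ => ?_
    rw [mul_smul_comm, mul_pow_of_commutator h hΔ, smul_add, smul_smul, smul_mul_assoc,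
      smul_mul_assoc, Nat.factorial_succ]
    congr 2
    have h1 : (k.factorial : ℂ) ≠ 0 := by exact_mod_cast k.factorial_ne_zero
    have h2 : ((k : ℂ) + 1) ≠ 0 := by exact_mod_cast k.succ_ne_zero
    push_cast
    field_simp
  rw [← exp_eq_sum_range hn', ← exp_eq_sum_range hn] at key
  exact key

theorem isNilpotent_exp_sub_one {A : Matrix ι ι ℂ} (hA : IsNilpotent A) :
    IsNilpotent (NormedSpace.exp A - 1) := by
  obtain ⟨n, hn⟩ := hA
  have hn' : A ^ (n + 1) = 0 := by rw [pow_succ, hn, zero_mul]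
  have h1 : NormedSpace.exp A - 1 =
      A * ∑ k ∈ Finset.range n, (((k + 1).factorial : ℂ)⁻¹) • A ^ k := by
    rw [exp_eq_sum_range hn', Finset.sum_range_succ', Finset.mul_sum]
    simp [pow_succ']
  have hc : Commute A (∑ k ∈ Finset.range n, (((k + 1).factorial : ℂ)⁻¹) • A ^ k) :=
    Commute.sum_right _ _ _ fun k _ => ((Commute.refl A).pow_right k).smul_right _
  rw [h1]
  exact hc.isNilpotent_mul_right ⟨n, hn⟩

/-- One-parameter groups of nilpotent matrices that agree at time one agree at all times. -/
theorem exp_smul_eq_of_exp_eq {A B : Matrix ι ι ℂ} (hA : IsNilpotent A) (hB : IsNilpotent B)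
    (h : NormedSpace.exp A = NormedSpace.exp B) (c : ℂ) :
    NormedSpace.exp (c • A) = NormedSpace.exp (c • B) := by
  obtain ⟨m, hm⟩ := hA
  obtain ⟨n, hn⟩ := hB
  -- For nilpotent C the entries of exp(cC) are polynomials in c, so agreement at all natural c,
  -- where exp(cC) is a power of exp C, suffices.
  have key : ∀ (C : Matrix ι ι ℂ) (k : ℕ), C ^ k = 0 → ∀ r s, ∃ p : Polynomial ℂ, ∀ c : ℂ,
      p.eval c = NormedSpace.exp (c • C) r s := by
    intro C k hk r s
    refine ⟨∑ l ∈ Finset.range k, Polynomial.C ((l.factorial : ℂ)⁻¹ * (C ^ l) r s) *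
      Polynomial.X ^ l, fun c => ?_⟩
    have hk' : (c • C) ^ k = 0 := by rw [smul_pow, hk, smul_zero]
    rw [exp_eq_sum_range hk', Polynomial.eval_finsetSum, Matrix.sum_apply]
    refine Finset.sum_congr rfl fun l _ => ?_
    simp [smul_pow]
    ring
  ext r s
  obtain ⟨p, hp⟩ := key A m hm r s
  obtain ⟨p', hp'⟩ := key B n hn r s
  have : p = p' := by
    refine Polynomial.eq_of_infinite_eval_eq p p'
      (Set.Infinite.mono ?_ (Set.infinite_range_of_injective (Nat.cast_injective (R := ℂ))))
    rintro _ ⟨l, rfl⟩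
    simp only [Set.mem_ofPred_eq, hp, hp', Nat.cast_smul_eq_nsmul, Matrix.exp_nsmul, h]
  rw [← hp, ← hp', this]

/-! ### Power series evaluated at a nilpotent matrix -/

/-- The value of a formal power series at a matrix `A` with `A ^ n = 0`. -/
def evalSeries (A : Matrix ι ι ℂ) (n : ℕ) (f : PowerSeries ℂ) : Matrix ι ι ℂ :=
  Polynomial.aeval A (f.trunc n)

theorem evalSeries_eq_sum (A : Matrix ι ι ℂ) (n : ℕ) (f : PowerSeries ℂ) :
    evalSeries A n f = ∑ k ∈ Finset.range n, PowerSeries.coeff k f • A ^ k := by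
  rw [evalSeries, Polynomial.aeval_def, PowerSeries.eval₂_trunc_eq_sum_range]
  simp [Algebra.smul_def]

theorem evalSeries_one (A : Matrix ι ι ℂ) (n : ℕ) (hA : A ^ n = 0) : evalSeries A n 1 = 1 := by
  rw [evalSeries_eq_sum]
  cases n with
  | zero => simpa using hA.symm
  | succ n => rw [Finset.sum_range_succ']; simp [PowerSeries.coeff_one]

theorem aeval_eq_of_trunc_eq {A : Matrix ι ι ℂ} {n : ℕ} (hA : A ^ n = 0) {p r : Polynomial ℂ}
    (h : (p : PowerSeries ℂ).trunc n = (r : PowerSeries ℂ).trunc n) :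
    Polynomial.aeval A p = Polynomial.aeval A r := by
  have : Polynomial.X ^ n ∣ p - r := by
    rw [Polynomial.X_pow_dvd_iff]
    intro d hd
    have := congrArg (fun s => Polynomial.coeff s d) h
    simpa [PowerSeries.coeff_trunc, hd, sub_eq_zero] using this
  obtain ⟨s, hs⟩ := this
  rw [← sub_eq_zero, ← map_sub, hs, map_mul, map_pow, Polynomial.aeval_X, hA, zero_mul]

theorem evalSeries_mul {A : Matrix ι ι ℂ} {n : ℕ} (hA : A ^ n = 0) (f g : PowerSeries ℂ) :
    evalSeries A n (f * g) = evalSeries A n f * evalSeries A n g := by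
  rw [evalSeries, evalSeries, evalSeries, ← map_mul]
  refine aeval_eq_of_trunc_eq hA ?_
  rw [PowerSeries.trunc_trunc, Polynomial.coe_mul, PowerSeries.trunc_trunc_mul_trunc]

theorem isNilpotent_evalSeries_sub {A : Matrix ι ι ℂ} {n : ℕ} (hA : A ^ (n + 1) = 0)
    (f : PowerSeries ℂ) :
    IsNilpotent (evalSeries A (n + 1) f - PowerSeries.constantCoeff f • (1 : Matrix ι ι ℂ)) := by
  have h1 : evalSeries A (n + 1) f - PowerSeries.constantCoeff f • (1 : Matrix ι ι ℂ) =
      A * ∑ k ∈ Finset.range n, PowerSeries.coeff (k + 1) f • A ^ k := by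
    rw [evalSeries_eq_sum, Finset.sum_range_succ', Finset.mul_sum]
    simp [pow_succ']
  rw [h1]
  refine Commute.isNilpotent_mul_right ?_ ⟨_, hA⟩
  exact Commute.sum_right _ _ _ fun k _ => ((Commute.refl A).pow_right k).smul_right _

end Nilpotent

/-! ### Matrices raising the weight by one step -/

section Superdiagonal

variable {N : ℕ}

/-- The matrix entries are concentrated on the first superdiagonal. -/
def IsSuperdiagonal (A : Matrix (Fin (N + 1)) (Fin (N + 1)) ℂ) : Prop :=
  ∀ r c : Fin (N + 1), (r : ℕ) + 1 ≠ c → A r c = 0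

theorem isSuperdiagonal_Jplus (N : ℕ) : IsSuperdiagonal (Jplus N) := fun r c h => by
  simp [Jplus, h]

theorem isSuperdiagonal_qJplus (q : ℂ) (N : ℕ) : IsSuperdiagonal (qJplus q N) := fun r c h => by
  simp [qJplus, h]

theorem IsSuperdiagonal.pow_apply {A : Matrix (Fin (N + 1)) (Fin (N + 1)) ℂ}
    (hA : IsSuperdiagonal A) (k : ℕ) (r c : Fin (N + 1)) (h : (r : ℕ) + k ≠ c) :
    (A ^ k) r c = 0 := by
  induction k generalizing c with
  | zero => rw [pow_zero, Matrix.one_apply_ne]; rintro rfl; simp at h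
  | succ k ih =>
    rw [pow_succ, Matrix.mul_apply]
    refine Finset.sum_eq_zero fun s _ => ?_
    by_cases hs : (r : ℕ) + k = s
    · rw [hA s c (by omega), mul_zero]
    · rw [ih s hs, zero_mul]

theorem IsSuperdiagonal.pow_eq_zero {A : Matrix (Fin (N + 1)) (Fin (N + 1)) ℂ}
    (hA : IsSuperdiagonal A) : A ^ (N + 1) = 0 := by
  ext r c
  exact hA.pow_apply _ r c (by omega)

theorem IsSuperdiagonal.diagonal_mul {A : Matrix (Fin (N + 1)) (Fin (N + 1)) ℂ}
    (hA : IsSuperdiagonal A) {d e : Fin (N + 1) → ℂ}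
    (h : ∀ r c : Fin (N + 1), (r : ℕ) + 1 = c → d r = e c) :
    Matrix.diagonal d * A = A * Matrix.diagonal e := by
  ext r c
  rw [Matrix.diagonal_mul, Matrix.mul_diagonal]
  by_cases hrc : (r : ℕ) + 1 = c
  · rw [h r c hrc, mul_comm]
  · rw [hA r c hrc, mul_zero, zero_mul]

theorem IsSuperdiagonal.J0_mul {A : Matrix (Fin (N + 1)) (Fin (N + 1)) ℂ}
    (hA : IsSuperdiagonal A) : J0 N * A = A * J0 N + (2 : ℂ) • A := by
  have : J0 N * A = A * Matrix.diagonal (fun i : Fin (N + 1) => ((N : ℂ) - 2 * ((i : ℕ) : ℂ)) + 2) := by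
    refine hA.diagonal_mul fun r c h => ?_
    rw [← h]; push_cast; ring
  rw [this, ← Matrix.diagonal_add, mul_add]
  congr 1
  ext r c
  rw [Matrix.mul_diagonal, Matrix.smul_apply, smul_eq_mul, mul_comm]

theorem IsSuperdiagonal.J0_mul_pow {A : Matrix (Fin (N + 1)) (Fin (N + 1)) ℂ}
    (hA : IsSuperdiagonal A) (n : ℕ) :
    J0 N * A ^ n = A ^ n * J0 N + (2 * (n : ℂ)) • A ^ n := by
  cases n with
  | zero => simp
  | succ n =>
    rw [mul_pow_of_commutator hA.J0_mul ((Commute.refl A).smul_left _), mul_smul_comm, ← pow_succ,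
      smul_smul]
    push_cast
    ring_nf

end Superdiagonal

/-! ### One leg of the Jordanian side -/

section Jordan

variable (h : ℂ) (N : ℕ)

/-- `(1 + (h J₊)²) ^ (1/2)`. -/
def sqrtJ : Matrix (Fin (N + 1)) (Fin (N + 1)) ℂ := sqrtOneAdd ((h • Jplus N) ^ 2)

/-- `(1 + (h J₊)²) ^ (-1/2)`. -/
def invSqrtJ : Matrix (Fin (N + 1)) (Fin (N + 1)) ℂ :=
  evalSeries ((h • Jplus N) ^ 2) (N + 1) (PowerSeries.binomialSeries ℂ (-1 / 2 : ℂ))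

/-- The power `T ^ a = exp (a h X)`. -/
def Tpow (a : ℂ) : Matrix (Fin (N + 1)) (Fin (N + 1)) ℂ := NormedSpace.exp (a • (h • X h N))

variable {h N}

theorem hJplus_sq_pow : ((h • Jplus N) ^ 2) ^ (N + 1) = 0 := by
  rw [← pow_mul, mul_comm, pow_mul, smul_pow, (isSuperdiagonal_Jplus N).pow_eq_zero]
  simp

theorem sqrtJ_eq : sqrtJ h N =
    evalSeries ((h • Jplus N) ^ 2) (N + 1) (PowerSeries.binomialSeries ℂ (1 / 2 : ℂ)) := by
  rw [sqrtJ, sqrtOneAdd, tsum_smul_pow_eq_sum _ hJplus_sq_pow, evalSeries_eq_sum]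
  simp

theorem sqrtJ_mul_invSqrtJ : sqrtJ h N * invSqrtJ h N = 1 := by
  rw [sqrtJ_eq, invSqrtJ, ← evalSeries_mul hJplus_sq_pow, ← PowerSeries.binomialSeries_add]
  norm_num
  exact evalSeries_one _ _ hJplus_sq_pow

theorem sqrtJ_mul_self : sqrtJ h N * sqrtJ h N = 1 + (h • Jplus N) ^ 2 := by
  rw [sqrtJ_eq, ← evalSeries_mul hJplus_sq_pow, ← PowerSeries.binomialSeries_add]
  have h2 : (1 / 2 + 1 / 2 : ℂ) = ((1 : ℕ) : ℂ) := by norm_num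
  rw [h2, PowerSeries.binomialSeries_nat, pow_one, evalSeries_eq_sum]
  -- For `N = 0` the truncation at order `N + 1` keeps only the constant term; the linear one is
  -- lost, but the matrix is then zero.
  rcases N with _ | N
  · have : (h • Jplus 0) ^ 2 = 0 := by simpa using hJplus_sq_pow (h := h) (N := 0)
    simp [this]
  · rw [Finset.sum_range_succ', Finset.sum_range_succ']
    simp [PowerSeries.coeff_one, PowerSeries.coeff_X, add_comm]

theorem commute_Jplus_sqrtJ : Commute (Jplus N) (sqrtJ h N) := by
  rw [sqrtJ_eq, evalSeries_eq_sum]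
  exact Commute.sum_right _ _ _ fun k _ =>
    ((((Commute.refl _).smul_right h).pow_right 2).pow_right k).smul_right _

theorem commute_Jplus_invSqrtJ : Commute (Jplus N) (invSqrtJ h N) := by
  rw [invSqrtJ, evalSeries_eq_sum]
  exact Commute.sum_right _ _ _ fun k _ =>
    ((((Commute.refl _).smul_right h).pow_right 2).pow_right k).smul_right _

/-- Both sides satisfy (k+1)c_{k+1} = -(k + 1/2)c_k. The formula identifies the derivative of the
arcsinh series with the binomial series of exponent -1/2. -/
theorem choose_neg_half (k : ℕ) :
    Ring.choose (-1 / 2 : ℂ) k = (-1) ^ k * (Nat.centralBinom k : ℂ) / 4 ^ k := by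
  induction k with
  | zero => simp
  | succ k ih =>
    have h1 : ((k : ℂ) + 1) * Ring.choose (-1 / 2 : ℂ) (k + 1) =
        (-1 / 2 - k) * Ring.choose (-1 / 2 : ℂ) k := by
      have := Ring.choose_smul_choose (-1 / 2 : ℂ) (Nat.le_succ k)
      rw [Nat.succ_sub (le_refl k), Nat.sub_self, Ring.choose_one_right, Nat.choose_succ_self_right,
        nsmul_eq_mul] at this
      push_cast at this
      rw [this, mul_comm]
    have h2 : ((k : ℂ) + 1) * (Nat.centralBinom (k + 1) : ℂ) =
        2 * (2 * k + 1) * (Nat.centralBinom k : ℂ) := by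
      exact_mod_cast Nat.succ_mul_centralBinom_succ k
    have h3 : ((k : ℂ) + 1) ≠ 0 := by exact_mod_cast k.succ_ne_zero
    apply mul_left_cancel₀ h3
    rw [h1, ih, mul_div_assoc', mul_div_assoc', mul_left_comm (k + 1 : ℂ), h2, pow_succ, pow_succ]
    field_simp
    ring

/-- The coefficients of `arcsinh`. -/
def arcsinhCoeff (h : ℂ) (k : ℕ) : ℂ :=
  (-1) ^ k * (Nat.centralBinom k : ℂ) / (4 ^ k * (2 * (k : ℂ) + 1)) * h ^ (2 * k)

theorem X_eq_sum : X h N =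
    ∑ k ∈ Finset.range (N + 1), arcsinhCoeff h k • Jplus N ^ (2 * k + 1) := by
  refine tsum_eq_sum fun k hk => ?_
  rw [pow_eq_zero_of_le _ (isSuperdiagonal_Jplus N).pow_eq_zero, smul_zero]
  simp at hk
  omega

theorem commute_Jplus_X : Commute (Jplus N) (X h N) := by
  rw [X_eq_sum]
  exact Commute.sum_right _ _ _ fun k _ => ((Commute.refl _).pow_right _).smul_right _

theorem isNilpotent_X : IsNilpotent (X h N) := by
  have h1 : X h N = Jplus N * ∑ k ∈ Finset.range (N + 1), arcsinhCoeff h k • Jplus N ^ (2 * k) := by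
    rw [X_eq_sum, Finset.mul_sum]
    simp [pow_succ']
  rw [h1]
  refine Commute.isNilpotent_mul_right ?_ ⟨_, (isSuperdiagonal_Jplus N).pow_eq_zero⟩
  exact Commute.sum_right _ _ _ fun k _ => ((Commute.refl _).pow_right _).smul_right _

/-- The commutator with J₀ multiplies J₊ⁿ by 2n, so it acts on series in x = J₊ as 2x d/dx, and the
derivative of arcsinh is (1 + x²)^(-1/2). -/
theorem J0_mul_X : J0 N * X h N = X h N * J0 N + (2 : ℂ) • (Jplus N * invSqrtJ h N) := by
  rw [X_eq_sum, invSqrtJ, evalSeries_eq_sum, Finset.mul_sum, Finset.sum_mul, Finset.mul_sum,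
    Finset.smul_sum, ← Finset.sum_add_distrib]
  refine Finset.sum_congr rfl fun k _ => ?_
  rw [mul_smul_comm, (isSuperdiagonal_Jplus N).J0_mul_pow, smul_add, smul_mul_assoc, mul_smul_comm,
    smul_smul, smul_smul, smul_pow, smul_pow, mul_smul_comm, smul_smul, ← pow_mul (Jplus N),
    ← pow_succ']
  congr 2
  have h3 : (2 * (k : ℂ) + 1) ≠ 0 := by exact_mod_cast (2 * k).succ_ne_zero
  rw [PowerSeries.binomialSeries_coeff, choose_neg_half, arcsinhCoeff]
  push_cast
  simp only [smul_eq_mul, ← pow_mul]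
  field_simp

theorem isNilpotent_smul_X (a : ℂ) : IsNilpotent (a • (h • X h N)) :=
  (isNilpotent_X.smul h).smul a

theorem Tpow_zero : Tpow h N 0 = 1 := by
  rw [Tpow, zero_smul, NormedSpace.exp_zero]

theorem Tpow_add (a b : ℂ) : Tpow h N (a + b) = Tpow h N a * Tpow h N b := by
  rw [Tpow, Tpow, Tpow, add_smul, Matrix.exp_add_of_commute]
  exact ((Commute.refl _).smul_left _).smul_right _

theorem Tpow_mul_Tpow_neg (a : ℂ) : Tpow h N a * Tpow h N (-a) = 1 := by
  rw [← Tpow_add, add_neg_cancel, Tpow_zero]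

theorem commute_Tpow_of_commute {A : Matrix (Fin (N + 1)) (Fin (N + 1)) ℂ}
    (hA : Commute A (X h N)) (a : ℂ) : Commute A (Tpow h N a) :=
  (exp_mul_of_mul_eq (((hA.smul_right h).smul_right a).symm.eq) (isNilpotent_smul_X a)
    (isNilpotent_smul_X a)).symm

theorem commute_Tpow (a b : ℂ) : Commute (Tpow h N a) (Tpow h N b) := by
  rw [Commute, SemiconjBy, ← Tpow_add, ← Tpow_add, add_comm a]

theorem commute_X_invSqrtJ : Commute (X h N) (invSqrtJ h N) := by
  rw [X_eq_sum]
  exact Commute.sum_left _ _ _ fun k _ => (commute_Jplus_invSqrtJ.pow_left _).smul_left _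

theorem commute_X_sqrtJ : Commute (X h N) (sqrtJ h N) := by
  rw [X_eq_sum]
  exact Commute.sum_left _ _ _ fun k _ => (commute_Jplus_sqrtJ.pow_left _).smul_left _

theorem J0_mul_Tpow (a : ℂ) : J0 N * Tpow h N a =
    Tpow h N a * J0 N + (2 * a * h) • (Tpow h N a * (Jplus N * invSqrtJ h N)) := by
  have h1 : J0 N * (a • (h • X h N)) =
      (a • (h • X h N)) * J0 N + (2 * a * h) • (Jplus N * invSqrtJ h N) := by
    rw [mul_smul_comm, mul_smul_comm, J0_mul_X, smul_mul_assoc, smul_mul_assoc]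
    module
  rw [Tpow, mul_exp_of_commutator h1 _ (isNilpotent_smul_X a), mul_smul_comm]
  have : Commute (Jplus N * invSqrtJ h N) (X h N) :=
    commute_Jplus_X.mul_left commute_X_invSqrtJ.symm
  exact ((this.smul_left _).smul_right _).smul_right _

/-- A unipotent polynomial in `J₊` commuting with `J₀` is trivial. -/
theorem eq_one_of_commute_J0 {A : Matrix (Fin (N + 1)) (Fin (N + 1)) ℂ}
    (hA : Commute (J0 N) A) (hn : IsNilpotent (A - 1)) : A = 1 := by
  -- The weights are pairwise distinct, so commuting with `J0` means being diagonal.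
  have hd : A - 1 = Matrix.diagonal fun i => (A - 1) i i := by
    ext r c
    by_cases hrc : r = c
    · subst hrc; simp
    · rw [Matrix.diagonal_apply_ne _ hrc]
      have := congrFun (congrFun (hA.sub_right (Commute.one_right _)).eq r) c
      rw [J0, Matrix.diagonal_mul, Matrix.mul_diagonal, mul_comm, ← sub_eq_zero, ← mul_sub,
        mul_eq_zero] at this
      refine this.resolve_right fun h0 => hrc ?_
      have h1 : ((r : ℕ) : ℂ) = ((c : ℕ) : ℂ) := by linear_combination (-1 / 2 : ℂ) * h0
      exact Fin.ext (by exact_mod_cast h1)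
  obtain ⟨n, hn⟩ := hn
  rw [hd, Matrix.diagonal_pow, Matrix.diagonal_eq_zero] at hn
  rw [← sub_eq_zero, hd, Matrix.diagonal_eq_zero]
  exact funext fun i => eq_zero_of_pow_eq_zero (congrFun hn i)

/-- The derivation ad J₀ is applied to r² = 1 + (hJ₊)², which gives 2rΔ = 4(hJ₊)² for Δ = [J₀, r].
The explicit series for Δ is needed only to see that Δ commutes with r. -/
theorem J0_mul_sqrtJ :
    J0 N * sqrtJ h N = sqrtJ h N * J0 N + (2 : ℂ) • ((h • Jplus N) ^ 2 * invSqrtJ h N) := by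
  set r := sqrtJ h N with hr
  set a := h • Jplus N with ha
  have hra : Commute a r := commute_Jplus_sqrtJ.smul_left h
  have hJ : ∀ k : ℕ, J0 N * a ^ k = a ^ k * J0 N + (2 * (k : ℂ)) • a ^ k := fun k => by
    rw [ha, smul_pow, mul_smul_comm, (isSuperdiagonal_Jplus N).J0_mul_pow, smul_add, smul_mul_assoc,
      smul_comm]
  obtain ⟨Δ, hΔ, hc⟩ : ∃ Δ, J0 N * r = r * J0 N + Δ ∧ Commute Δ r := by
    refine ⟨∑ k ∈ Finset.range (N + 1), (PowerSeries.coeff k (PowerSeries.binomialSeries ℂ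
      (1 / 2 : ℂ)) * (2 * ((2 * k : ℕ) : ℂ))) • a ^ (2 * k), ?_, ?_⟩
    · rw [hr, sqrtJ_eq, evalSeries_eq_sum, Finset.mul_sum, Finset.sum_mul, ← Finset.sum_add_distrib]
      refine Finset.sum_congr rfl fun k _ => ?_
      rw [mul_smul_comm, ← pow_mul, hJ, smul_add, smul_mul_assoc, smul_smul]
    · exact Commute.sum_left _ _ _ fun k _ => (hra.pow_left _).smul_left _
  have h1 : J0 N * (r * r) = r * r * J0 N + (r * Δ + Δ * r) := by
    rw [← mul_assoc, hΔ, add_mul, mul_assoc, hΔ]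
    noncomm_ring
  have h2 : J0 N * (r * r) = r * r * J0 N + (4 : ℂ) • a ^ 2 := by
    rw [hr, sqrtJ_mul_self, mul_add, hJ, add_mul]
    norm_num
    rw [add_assoc]
  rw [h1, hc.eq, add_right_inj, ← two_smul ℂ] at h2
  have h3 : r * Δ = (2 : ℂ) • a ^ 2 := by
    have := congrArg ((2 : ℂ)⁻¹ • ·) h2
    simp only [smul_smul] at this
    norm_num at this
    exact this
  have hi : invSqrtJ h N * r = 1 := mul_eq_one_comm.1 sqrtJ_mul_invSqrtJ
  have hai : Commute a (invSqrtJ h N) := commute_Jplus_invSqrtJ.smul_left h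
  rw [hΔ, ← one_mul Δ, ← hi, mul_assoc, h3, mul_smul_comm, (hai.pow_left 2).eq]

theorem sqrtJ_sub_mul_sqrtJ_add :
    (sqrtJ h N - h • Jplus N) * (h • Jplus N + sqrtJ h N) = 1 := by
  have hra : Commute (h • Jplus N) (sqrtJ h N) := commute_Jplus_sqrtJ.smul_left h
  rw [sub_mul, mul_add, mul_add, sqrtJ_mul_self, hra.eq, sq]
  abel

theorem isNilpotent_hJplus : IsNilpotent (h • Jplus N) :=
  IsNilpotent.smul ⟨_, (isSuperdiagonal_Jplus N).pow_eq_zero⟩ h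

theorem isNilpotent_sqrtJ_sub_one : IsNilpotent (sqrtJ h N - 1) := by
  have := isNilpotent_evalSeries_sub (hJplus_sq_pow (h := h) (N := N))
    (PowerSeries.binomialSeries ℂ (1 / 2 : ℂ))
  rwa [PowerSeries.binomialSeries_constantCoeff, one_smul, ← sqrtJ_eq] at this

theorem isNilpotent_Tpow_sub_one (a : ℂ) : IsNilpotent (Tpow h N a - 1) :=
  isNilpotent_exp_sub_one (isNilpotent_smul_X a)

/-- Under ad J₀, exp(hX) and T̃ have the same logarithmic derivative 2hJ₊(1 + (hJ₊)²)^(-1/2). As r -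
hJ₊ is the inverse of T̃, the product (r - hJ₊)exp(hX) commutes with J₀; it is also unipotent, hence
equal to 1. -/
theorem Tpow_one : Tpow h N 1 = Ttilde h N := by
  have hTt : Ttilde h N = h • Jplus N + sqrtJ h N := rfl
  have hJr : Commute (h • Jplus N) (sqrtJ h N) := commute_Jplus_sqrtJ.smul_left h
  have hJi : Commute (h • Jplus N) (invSqrtJ h N) := commute_Jplus_invSqrtJ.smul_left h
  have hJE : Commute (h • Jplus N) (Tpow h N 1) :=
    commute_Tpow_of_commute (commute_Jplus_X.smul_left h) 1
  have hrE : Commute (sqrtJ h N) (Tpow h N 1) := commute_Tpow_of_commute commute_X_sqrtJ.symm 1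
  have hiE : Commute (invSqrtJ h N) (Tpow h N 1) := commute_Tpow_of_commute commute_X_invSqrtJ.symm 1
  have hri : sqrtJ h N * invSqrtJ h N = 1 := sqrtJ_mul_invSqrtJ
  have hir : invSqrtJ h N * sqrtJ h N = 1 := mul_eq_one_comm.1 hri
  have hJ0J : J0 N * (h • Jplus N) = (h • Jplus N) * J0 N + (2 : ℂ) • (h • Jplus N) := by
    rw [mul_smul_comm, (isSuperdiagonal_Jplus N).J0_mul, smul_mul_assoc]
    module
  have hJ0r := J0_mul_sqrtJ (h := h) (N := N)
  have hJ0E : J0 N * Tpow h N 1 = Tpow h N 1 * J0 N +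
      (2 : ℂ) • (Tpow h N 1 * (h • Jplus N * invSqrtJ h N)) := by
    rw [J0_mul_Tpow, smul_mul_assoc, mul_smul_comm]
    module
  have hinv := sqrtJ_sub_mul_sqrtJ_add (h := h) (N := N)
  have hnil : IsNilpotent (h • Jplus N) := isNilpotent_hJplus
  have hrnil := isNilpotent_sqrtJ_sub_one (h := h) (N := N)
  have hEnil := isNilpotent_Tpow_sub_one (h := h) (N := N) 1
  rw [hTt]
  generalize h • Jplus N = a at *
  generalize sqrtJ h N = r at *
  generalize invSqrtJ h N = i at *
  generalize Tpow h N 1 = E at *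
  have key : (r - a) * E = 1 := by
    refine eq_one_of_commute_J0 (N := N) ?_ ?_
    · have hs : Commute (a * i) (r - a) := by
        refine Commute.sub_right (hJr.mul_left ?_) ((Commute.refl a).mul_left hJi.symm)
        rw [Commute, SemiconjBy, hri, hir]
      have hE : Commute (a * i) E := hJE.mul_left hiE
      have h1 : J0 N * (r - a) = (r - a) * J0 N - (2 : ℂ) • ((r - a) * (a * i)) := by
        rw [mul_sub, hJ0r, hJ0J, ← hs.eq, mul_sub (a * i), mul_assoc a i r, hir, mul_one,
          mul_assoc a i a, ← hJi.eq, ← mul_assoc, ← sq, sub_mul]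
        module
      rw [Commute, SemiconjBy, ← mul_assoc, h1, sub_mul, mul_assoc, hJ0E, smul_mul_assoc, mul_assoc,
        hE.eq, mul_add, mul_smul_comm, mul_assoc]
      abel
    · have h1 : (r - a) * E - 1 = (r - a) * (E - 1) + ((r - 1) - a) := by noncomm_ring
      have hc : Commute (r - a) (E - 1) := (hrE.sub_left hJE).sub_right (Commute.one_right _)
      have hn2 : IsNilpotent ((r - 1) - a) :=
        (hJr.symm.sub_left (Commute.one_left a)).isNilpotent_sub hrnil hnil
      rw [h1]
      refine Commute.isNilpotent_add ?_ (hc.isNilpotent_mul_left hEnil) hn2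
      have hra' : Commute r (r - 1 - a) :=
        ((Commute.refl r).sub_right (Commute.one_right r)).sub_right hJr.symm
      have haa : Commute a (r - 1 - a) :=
        (hJr.sub_right (Commute.one_right a)).sub_right (Commute.refl a)
      have hEE : Commute E (r - 1 - a) :=
        (hrE.symm.sub_right (Commute.one_right E)).sub_right hJE.symm
      exact (hra'.sub_left haa).mul_left (hEE.sub_left (Commute.one_left _))
  calc E = (a + r) * ((r - a) * E) := by
        rw [← mul_assoc, mul_eq_one_comm.1 hinv, one_mul]
    _ = a + r := by rw [key, mul_one]

theorem T_eq_Tpow : T h N = Tpow h N 1 := by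
  rw [T, Tpow, one_smul]

theorem T_eq_Ttilde : T h N = Ttilde h N := by
  rw [T_eq_Tpow, Tpow_one]

theorem Tpow_one_eq : Tpow h N 1 = h • Jplus N + sqrtJ h N := Tpow_one

theorem Tpow_neg_one_eq : Tpow h N (-1) = sqrtJ h N - h • Jplus N := by
  have h1 := Tpow_mul_Tpow_neg (h := h) (N := N) 1
  calc Tpow h N (-1) = (sqrtJ h N - h • Jplus N) * (Tpow h N 1 * Tpow h N (-1)) := by
        rw [← mul_assoc, Tpow_one_eq, sqrtJ_sub_mul_sqrtJ_add, one_mul]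
    _ = _ := by rw [h1, mul_one]

/-- `T H`, the generator that appears in the Jordanian twist. -/
def twistGen (h : ℂ) (N : ℕ) : Matrix (Fin (N + 1)) (Fin (N + 1)) ℂ := T h N * H h N

theorem twistGen_eq : twistGen h N = Tpow h N 1 * (sqrtJ h N * J0 N) := by
  rw [twistGen, T_eq_Tpow]
  rfl

/-- The square root in H cancels the inverse square root produced by [J₀, Tᵃ]. -/
theorem twistGen_mul_Tpow (a : ℂ) : twistGen h N * Tpow h N a =
    Tpow h N a * twistGen h N + (2 * a) • (Tpow h N (a + 1) * (h • Jplus N)) := by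
  have hrT : Commute (sqrtJ h N) (Tpow h N a) := commute_Tpow_of_commute commute_X_sqrtJ.symm a
  have hri := sqrtJ_mul_invSqrtJ (h := h) (N := N)
  have h2 : sqrtJ h N * (Tpow h N a * (Jplus N * invSqrtJ h N)) = Tpow h N a * Jplus N := by
    rw [← mul_assoc, hrT.eq, mul_assoc, ← mul_assoc (sqrtJ h N), ← commute_Jplus_sqrtJ.eq,
      mul_assoc, hri, mul_one]
  rw [twistGen_eq, mul_assoc, mul_assoc, J0_mul_Tpow, mul_add, mul_smul_comm, h2, mul_add,
    ← mul_assoc (sqrtJ h N), hrT.eq, mul_assoc (Tpow h N a), ← mul_assoc (Tpow h N 1),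
    (commute_Tpow 1 a).eq, mul_assoc, add_comm a 1, Tpow_add, mul_smul_comm, mul_smul_comm,
    smul_smul, mul_assoc (Tpow h N 1)]

/-- `1 - T⁻²` raises the eigenvalues of the twist generator by two. -/
theorem twistGen_mul_one_sub : twistGen h N * (1 - Tpow h N (-2)) =
    (1 - Tpow h N (-2)) * (twistGen h N + (2 : ℂ) • 1) := by
  have h1 := twistGen_mul_Tpow (h := h) (N := N) (-2)
  have h2 : (2 : ℂ) • (h • Jplus N) = Tpow h N 1 - Tpow h N (-1) := by
    rw [Tpow_one_eq, Tpow_neg_one_eq]; module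
  have h3 : (2 * -2 : ℂ) • (Tpow h N (-2 + 1) * (h • Jplus N)) =
      -((2 : ℂ) • (1 - Tpow h N (-2))) := by
    rw [show (2 * -2 : ℂ) = -2 * 2 by ring, mul_smul, ← mul_smul_comm, h2, mul_sub, ← Tpow_add,
      ← Tpow_add]
    norm_num [Tpow_zero]
  rw [h3] at h1
  rw [mul_sub, h1, mul_add, sub_mul, mul_smul_comm, mul_one, mul_one, one_mul]
  abel

/-- The vector `T ^ (-w / 2) |w⟩` is an eigenvector of the twist generator. -/
theorem twistGen_mul_Tpow_mul {P : Matrix (Fin (N + 1)) (Fin (N + 1)) ℂ} {w : ℂ}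
    (hP : J0 N * P = w • P) :
    twistGen h N * (Tpow h N (-w / 2) * P) = w • (Tpow h N (-w / 2) * P) := by
  have h1 : twistGen h N * P = w • (Tpow h N 1 * (sqrtJ h N * P)) := by
    rw [twistGen_eq, mul_assoc, mul_assoc, hP, mul_smul_comm, mul_smul_comm]
  -- The commutator term turns the square root into (1 + (hJ₊)²)^(1/2) - hJ₊ = T⁻¹, which cancels
  -- the factor T of the generator.
  rw [← mul_assoc, twistGen_mul_Tpow, add_mul, mul_assoc, h1, add_comm _ (1 : ℂ), Tpow_add,
    mul_smul_comm, ← mul_assoc, (commute_Tpow _ 1).eq, show (2 * (-w / 2)) = -w by ring,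
    smul_mul_assoc, neg_smul, ← sub_eq_add_neg, ← smul_sub, mul_assoc (Tpow h N 1 * _), ← mul_sub,
    ← sub_mul, ← Tpow_neg_one_eq, (commute_Tpow 1 _).eq, mul_assoc, ← mul_assoc (Tpow h N 1),
    Tpow_mul_Tpow_neg, one_mul]

end Jordan

/-! ### The symmetric twist -/

section Twist

variable {ι : Type*} [Fintype ι] [DecidableEq ι]

theorem exp_smul_add {x₁ x₂ : Matrix ι ι ℂ} (h : Commute x₁ x₂) (c : ℂ) :
    NormedSpace.exp (c • (x₁ + x₂)) = NormedSpace.exp (c • x₁) * NormedSpace.exp (c • x₂) := by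
  rw [smul_add, Matrix.exp_add_of_commute]
  exact (h.smul_left _).smul_right _

theorem exp_add_smul (x : Matrix ι ι ℂ) (a b : ℂ) :
    NormedSpace.exp ((a + b) • x) = NormedSpace.exp (a • x) * NormedSpace.exp (b • x) := by
  rw [add_smul, Matrix.exp_add_of_commute]
  exact ((Commute.refl x).smul_left _).smul_right _

theorem commute_exp {A x : Matrix ι ι ℂ} (h : Commute A x) (hx : IsNilpotent x) :
    Commute A (NormedSpace.exp x) :=
  (exp_mul_of_mul_eq h.symm.eq hx hx).symm

/-- Since d₁ is shifted by 2 across z = 1 - e^(-2x₁), moving z to the left of exp(d₁x₂) creates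
e^(2x₂), which e^(-2x₂) absorbs. What remains, e^(-2x₂) - z, is symmetric in the two legs. -/
theorem exp_twist_mul_exp {x₁ x₂ d₁ : Matrix ι ι ℂ} (hx₁ : IsNilpotent x₁) (hx₂ : IsNilpotent x₂)
    (hxx : Commute x₁ x₂) (hdx : Commute d₁ x₂)
    (hd : d₁ * (1 - NormedSpace.exp ((-2 : ℂ) • x₁)) =
      (1 - NormedSpace.exp ((-2 : ℂ) • x₁)) * (d₁ + (2 : ℂ) • 1)) :
    NormedSpace.exp (d₁ * x₂) * NormedSpace.exp ((-2 : ℂ) • (x₁ + x₂)) =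
      (NormedSpace.exp ((-2 : ℂ) • x₁) + NormedSpace.exp ((-2 : ℂ) • x₂) - 1) *
        NormedSpace.exp (d₁ * x₂) := by
  set z := 1 - NormedSpace.exp ((-2 : ℂ) • x₁) with hz
  have hA : IsNilpotent (d₁ * x₂) := hdx.isNilpotent_mul_left hx₂
  have hx2z : Commute x₂ z := (Commute.one_right _).sub_right
    (commute_exp (hxx.symm.smul_right _) (hx₁.smul _))
  have hx2A : Commute x₂ (d₁ * x₂) := hdx.symm.mul_right (Commute.refl _)
  have hAz : d₁ * x₂ * z = z * (d₁ * x₂ + (2 : ℂ) • x₂) := by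
    rw [mul_assoc, hx2z.eq, ← mul_assoc, hd, mul_assoc, add_mul, smul_mul_assoc, one_mul]
  have h1 : NormedSpace.exp (d₁ * x₂) * z =
      z * (NormedSpace.exp (d₁ * x₂) * NormedSpace.exp ((2 : ℂ) • x₂)) := by
    have hn : IsNilpotent (d₁ * x₂ + (2 : ℂ) • x₂) :=
      (hx2A.symm.smul_right _).isNilpotent_add hA (hx₂.smul _)
    rw [exp_mul_of_mul_eq hAz hA hn, Matrix.exp_add_of_commute _ _ (hx2A.symm.smul_right _)]
  have h2 : NormedSpace.exp ((2 : ℂ) • x₂) * NormedSpace.exp ((-2 : ℂ) • x₂) = 1 := by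
    rw [← exp_add_smul]; simp
  have h3 : Commute (NormedSpace.exp ((-2 : ℂ) • x₂)) (NormedSpace.exp (d₁ * x₂)) :=
    commute_exp (commute_exp (hx2A.symm.smul_right _) (hx₂.smul _)).symm hA
  have h4 : NormedSpace.exp ((-2 : ℂ) • x₁) = 1 - z := by rw [hz]; abel
  rw [exp_smul_add hxx, h4, ← mul_assoc, mul_sub, h1, sub_mul, mul_assoc z,
    mul_assoc (NormedSpace.exp (d₁ * x₂)) (NormedSpace.exp ((2 : ℂ) • x₂)), h2, mul_one,
    ← h3.eq]
  noncomm_ring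

theorem exp_twist_mul_eigenvector {x₁ x₂ d₁ P : Matrix ι ι ℂ} (hx₁ : IsNilpotent x₁)
    (hx₂ : IsNilpotent x₂) (hxx : Commute x₁ x₂) (hdx : Commute d₁ x₂) {w : ℂ}
    (hd : d₁ * (NormedSpace.exp ((-w / 2) • x₁) * P) = w • (NormedSpace.exp ((-w / 2) • x₁) * P))
    (b : ℂ) :
    NormedSpace.exp (d₁ * x₂) *
        (NormedSpace.exp ((-w / 2) • x₁) * NormedSpace.exp (b • x₂) * P) =
      NormedSpace.exp ((-w / 2) • x₁) * NormedSpace.exp ((w + b) • x₂) * P := by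
  have hc : Commute (NormedSpace.exp (b • x₂)) (NormedSpace.exp ((-w / 2) • x₁)) :=
    commute_exp (commute_exp ((hxx.smul_left _).smul_right _) (hx₂.smul _)).symm (hx₁.smul _)
  have hdc : Commute d₁ (NormedSpace.exp (b • x₂)) :=
    commute_exp (hdx.smul_right _) (hx₂.smul _)
  have hxc : Commute x₂ (NormedSpace.exp ((-w / 2) • x₁)) :=
    commute_exp (hxx.symm.smul_right _) (hx₁.smul _)
  have h1 : d₁ * x₂ * (NormedSpace.exp ((-w / 2) • x₁) * NormedSpace.exp (b • x₂) * P) =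
      (w • x₂) * (NormedSpace.exp ((-w / 2) • x₁) * NormedSpace.exp (b • x₂) * P) := by
    rw [← hc.eq, mul_assoc (NormedSpace.exp (b • x₂)), hdx.eq, mul_assoc x₂, ← mul_assoc d₁,
      hdc.eq, mul_assoc _ d₁, hd, mul_smul_comm, mul_smul_comm, smul_mul_assoc]
  rw [exp_mul_congr h1 ((hdx.mul_left (Commute.refl x₂)).smul_right w)
    (hdx.isNilpotent_mul_left hx₂) (hx₂.smul w), exp_add_smul, ← mul_assoc, ← mul_assoc,
    ← (commute_exp (hxc.symm.smul_right w) (hx₂.smul w)).eq,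
    mul_assoc (NormedSpace.exp ((-w / 2) • x₁))]

/-- The point is that one and the same `Q` serves both exponentials. For c = -2 this is the symmetry
of the conjugate in `exp_twist_mul_exp`. -/
theorem exists_exp_twist_mul_exp {x₁ x₂ d₁ d₂ : Matrix ι ι ℂ} (hx₁ : IsNilpotent x₁)
    (hx₂ : IsNilpotent x₂) (hxx : Commute x₁ x₂) (hdx : Commute d₁ x₂) (hdx' : Commute d₂ x₁)
    (hd₁ : d₁ * (1 - NormedSpace.exp ((-2 : ℂ) • x₁)) =
      (1 - NormedSpace.exp ((-2 : ℂ) • x₁)) * (d₁ + (2 : ℂ) • 1))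
    (hd₂ : d₂ * (1 - NormedSpace.exp ((-2 : ℂ) • x₂)) =
      (1 - NormedSpace.exp ((-2 : ℂ) • x₂)) * (d₂ + (2 : ℂ) • 1)) (c : ℂ) :
    ∃ Q : Matrix ι ι ℂ,
      NormedSpace.exp (d₁ * x₂) * NormedSpace.exp (c • (x₁ + x₂)) =
        Q * NormedSpace.exp (d₁ * x₂) ∧
      NormedSpace.exp (d₂ * x₁) * NormedSpace.exp (c • (x₁ + x₂)) =
        Q * NormedSpace.exp (d₂ * x₁) := by
  have hu := Matrix.isUnit_exp (d₁ * x₂)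
  have hu' := Matrix.isUnit_exp (d₂ * x₁)
  set y := x₁ + x₂ with hy
  set E := NormedSpace.exp (d₁ * x₂) with hE
  set E' := NormedSpace.exp (d₂ * x₁) with hE'
  have hyn : IsNilpotent y := hxx.isNilpotent_add hx₁ hx₂
  have hconj : ∀ F : Matrix ι ι ℂ, IsUnit F → IsNilpotent (F * y * F⁻¹) := by
    rintro F hF
    obtain ⟨n, hn⟩ := hyn
    refine ⟨n, ?_⟩
    have hFF : F⁻¹ * F = 1 := Matrix.nonsing_inv_mul _ ((Matrix.isUnit_iff_isUnit_det _).1 hF)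
    have : SemiconjBy F y (F * y * F⁻¹) := by
      rw [SemiconjBy, mul_assoc, hFF, mul_one]
    have h2 := (this.pow_right n).eq
    rw [hn, mul_zero] at h2
    exact hF.mul_left_eq_zero.1 h2.symm
  have hinv : ∀ F : Matrix ι ι ℂ, IsUnit F → F⁻¹ * F = 1 := fun F hF =>
    Matrix.nonsing_inv_mul _ ((Matrix.isUnit_iff_isUnit_det _).1 hF)
  have hinv' : ∀ F : Matrix ι ι ℂ, IsUnit F → F * F⁻¹ = 1 := fun F hF =>
    Matrix.mul_nonsing_inv _ ((Matrix.isUnit_iff_isUnit_det _).1 hF)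
  have hexp : ∀ F : Matrix ι ι ℂ, IsUnit F → ∀ a : ℂ,
      NormedSpace.exp (a • (F * y * F⁻¹)) = F * NormedSpace.exp (a • y) * F⁻¹ := fun F hF a => by
    rw [← Matrix.exp_conj _ _ hF, mul_smul_comm, smul_mul_assoc]
  have h1 := exp_twist_mul_exp hx₁ hx₂ hxx hdx hd₁
  have h2 := exp_twist_mul_exp hx₂ hx₁ hxx.symm hdx' hd₂
  rw [← hE, ← hy] at h1
  rw [← hE', add_comm x₂, ← hy, add_comm (NormedSpace.exp ((-2 : ℂ) • x₂))] at h2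
  have h3 : NormedSpace.exp ((-2 : ℂ) • (E * y * E⁻¹)) =
      NormedSpace.exp ((-2 : ℂ) • (E' * y * E'⁻¹)) := by
    rw [hexp E hu, hexp E' hu', h1, h2, mul_assoc, mul_assoc, hinv' E hu, hinv' E' hu']
  -- The two conjugates of the nilpotent `y` generate one-parameter groups that agree at -2, hence
  -- at every multiple of -2; the multiple -c/2 gives c.
  have h4 := exp_smul_eq_of_exp_eq ((hconj E hu).smul _) ((hconj E' hu').smul _) h3 (-c / 2)
  rw [smul_smul, smul_smul, show (-c / 2 * -2 : ℂ) = c by ring, hexp E hu, hexp E' hu'] at h4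
  refine ⟨E * NormedSpace.exp (c • y) * E⁻¹, ?_, ?_⟩
  · rw [mul_assoc _ E⁻¹, hinv E hu, mul_one]
  · rw [h4, mul_assoc _ E'⁻¹, hinv E' hu', mul_one]

end Twist

/-! ### Two legs -/

section ColTwist

variable {m n : Type*}

/-- The matrix whose column with index `(i, j)` is that of `A j ⊗ B i`. -/
def colTwist (A : n → Matrix m m ℂ) (B : m → Matrix n n ℂ) : Matrix (m × n) (m × n) ℂ :=
  Matrix.of fun r c => A c.2 r.1 c.1 * B c.1 r.2 c.2

theorem tendsto_colTwist {α : Type*} {l : Filter α} {A : α → n → Matrix m m ℂ}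
    {B : α → m → Matrix n n ℂ} {A' : n → Matrix m m ℂ} {B' : m → Matrix n n ℂ}
    (hA : ∀ j, Tendsto (fun x => A x j) l (𝓝 (A' j)))
    (hB : ∀ i, Tendsto (fun x => B x i) l (𝓝 (B' i))) :
    Tendsto (fun x => colTwist (A x) (B x)) l (𝓝 (colTwist A' B')) := by
  refine tendsto_pi_nhds.2 fun r => tendsto_pi_nhds.2 fun c => ?_
  exact (tendsto_pi_nhds.1 (tendsto_pi_nhds.1 (hA c.2) r.1) c.1).mul
    (tendsto_pi_nhds.1 (tendsto_pi_nhds.1 (hB c.1) r.2) c.2)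

end ColTwist

section Legs

variable {m n : Type*} [Fintype m] [Fintype n] [DecidableEq m] [DecidableEq n]

/-- The embedding `A ↦ A ⊗ 1`. -/
def leg₁ (m n : Type*) [Fintype m] [Fintype n] [DecidableEq m] [DecidableEq n] :
    Matrix m m ℂ →ₐ[ℂ] Matrix (m × n) (m × n) ℂ :=
  AlgHom.ofLinearMap
    { toFun := fun A => A ⊗ₖ (1 : Matrix n n ℂ)
      map_add' := fun A B => Matrix.add_kronecker A B _
      map_smul' := fun c A => Matrix.smul_kronecker c A _ }
    Matrix.one_kronecker_one
    (fun A B => by simp [← Matrix.mul_kronecker_mul])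

/-- The embedding `B ↦ 1 ⊗ B`. -/
def leg₂ (m n : Type*) [Fintype m] [Fintype n] [DecidableEq m] [DecidableEq n] :
    Matrix n n ℂ →ₐ[ℂ] Matrix (m × n) (m × n) ℂ :=
  AlgHom.ofLinearMap
    { toFun := fun B => (1 : Matrix m m ℂ) ⊗ₖ B
      map_add' := fun A B => Matrix.kronecker_add _ A B
      map_smul' := fun c A => Matrix.kronecker_smul c _ A }
    Matrix.one_kronecker_one
    (fun A B => by simp [← Matrix.mul_kronecker_mul])

theorem leg₁_mul_leg₂ (A : Matrix m m ℂ) (B : Matrix n n ℂ) :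
    leg₁ m n A * leg₂ m n B = A ⊗ₖ B := by
  change (A ⊗ₖ 1) * (1 ⊗ₖ B) = _
  rw [← Matrix.mul_kronecker_mul, mul_one, one_mul]

theorem commute_leg₁_leg₂ (A : Matrix m m ℂ) (B : Matrix n n ℂ) :
    Commute (leg₁ m n A) (leg₂ m n B) := by
  change (A ⊗ₖ 1) * (1 ⊗ₖ B) = (1 ⊗ₖ B) * (A ⊗ₖ 1)
  rw [← Matrix.mul_kronecker_mul, ← Matrix.mul_kronecker_mul, mul_one, one_mul, mul_one, one_mul]

theorem map_exp_of_isNilpotent {A : Matrix m m ℂ} (hA : IsNilpotent A)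
    (f : Matrix m m ℂ →ₐ[ℂ] Matrix n n ℂ) : f (NormedSpace.exp A) = NormedSpace.exp (f A) := by
  obtain ⟨k, hk⟩ := hA
  have hk' : f A ^ k = 0 := by rw [← map_pow, hk, map_zero]
  rw [exp_eq_sum_range hk, exp_eq_sum_range hk', map_sum]
  simp

/-- The projection to a basis vector. -/
def basisProj (c : m) : Matrix m m ℂ := Matrix.single c c 1

theorem mul_basisProj_apply (A : Matrix m m ℂ) (r s c : m) :
    (A * basisProj c) r s = if s = c then A r c else 0 := by
  rw [basisProj, Matrix.mul_apply, Finset.sum_eq_single c]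
  · by_cases h : s = c
    · simp [h]
    · simp [Matrix.single, h, Ne.symm h]
  · intro b _ hb
    simp [Matrix.single, hb.symm]
  · simp

theorem eq_of_mul_basisProj_eq {A B : Matrix m m ℂ}
    (h : ∀ c, A * basisProj c = B * basisProj c) : A = B := by
  ext r c
  simpa [mul_basisProj_apply] using congrFun (congrFun (h c) r) c

theorem leg_basisProj (c : m × n) :
    leg₁ m n (basisProj c.1) * leg₂ m n (basisProj c.2) = basisProj c := by
  rw [leg₁_mul_leg₂, basisProj, basisProj, Matrix.single_kronecker_single, mul_one]
  rfl

theorem colTwist_mul_basisProj (A : n → Matrix m m ℂ) (B : m → Matrix n n ℂ) (c : m × n) :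
    colTwist A B * basisProj c = leg₁ m n (A c.2) * leg₂ m n (B c.1) * basisProj c := by
  ext r s
  rw [leg₁_mul_leg₂, mul_basisProj_apply, mul_basisProj_apply]
  rfl

theorem kronecker_mul_colTwist (C : Matrix m m ℂ) (D : Matrix n n ℂ) (A : n → Matrix m m ℂ)
    (B : m → Matrix n n ℂ) :
    (C ⊗ₖ D) * colTwist A B = colTwist (fun j => C * A j) (fun i => D * B i) := by
  refine eq_of_mul_basisProj_eq fun c => ?_
  rw [mul_assoc, colTwist_mul_basisProj, colTwist_mul_basisProj, leg₁_mul_leg₂, leg₁_mul_leg₂,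
    ← mul_assoc, ← Matrix.mul_kronecker_mul]

end Legs

/-! ### The Jordanian `R` matrix as a quotient of twists -/

section JordanTwist

variable (h : ℂ) (N₁ N₂ : ℕ)

/-- The weight `2 m` of the basis vector with index `i`. -/
def weight (N : ℕ) (i : Fin (N + 1)) : ℂ := (N : ℂ) - 2 * ((i : ℕ) : ℂ)

theorem J0_mul_basisProj {N : ℕ} (i : Fin (N + 1)) :
    J0 N * basisProj i = weight N i • basisProj i := by
  ext r c
  rw [mul_basisProj_apply, Matrix.smul_apply, J0, basisProj, Matrix.diagonal_apply, Matrix.single]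
  by_cases h1 : c = i <;> by_cases h2 : r = i <;>
    simp [h1, h2, weight] <;> intros <;> simp_all

/-- The matrix sending `|w₁⟩ ⊗ |w₂⟩` to `T ^ (s w₂ / 2) |w₁⟩ ⊗ T ^ (-s w₁ / 2) |w₂⟩`. -/
def jordanTwist (s : ℂ) : Matrix (Fin (N₁ + 1) × Fin (N₂ + 1)) (Fin (N₁ + 1) × Fin (N₂ + 1)) ℂ :=
  colTwist (fun j => Tpow h N₁ (s * weight N₂ j / 2)) (fun i => Tpow h N₂ (-(s * weight N₁ i) / 2))

variable {h N₁ N₂}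

/-- As `Rh` = exp(-d₂x₁) exp(d₁x₂), it suffices that exp(d₁x₂) and exp(d₂x₁) send the respective
twists to the same matrix. This is checked on each weight vector. -/
theorem Rh_mul_jordanTwist : Rh h N₁ N₂ * jordanTwist h N₁ N₂ 1 = jordanTwist h N₁ N₂ (-1) := by
  set l₁ := leg₁ (Fin (N₁ + 1)) (Fin (N₂ + 1)) with hl₁
  set l₂ := leg₂ (Fin (N₁ + 1)) (Fin (N₂ + 1)) with hl₂
  set x₁ := l₁ (h • X h N₁) with hx₁
  set x₂ := l₂ (h • X h N₂) with hx₂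
  set d₁ := l₁ (twistGen h N₁) with hd₁
  set d₂ := l₂ (twistGen h N₂) with hd₂
  have hn₁ : IsNilpotent x₁ := (isNilpotent_X.smul h).map l₁
  have hn₂ : IsNilpotent x₂ := (isNilpotent_X.smul h).map l₂
  have hxx : Commute x₁ x₂ := commute_leg₁_leg₂ _ _
  have hdx : Commute d₁ x₂ := commute_leg₁_leg₂ _ _
  have hdx' : Commute d₂ x₁ := (commute_leg₁_leg₂ _ _).symm
  have he₁ : ∀ a : ℂ, l₁ (Tpow h N₁ a) = NormedSpace.exp (a • x₁) := fun a => by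
    rw [Tpow, map_exp_of_isNilpotent (isNilpotent_smul_X a), map_smul]
  have he₂ : ∀ a : ℂ, l₂ (Tpow h N₂ a) = NormedSpace.exp (a • x₂) := fun a => by
    rw [Tpow, map_exp_of_isNilpotent (isNilpotent_smul_X a), map_smul]
  have hq₁ : d₁ * (1 - NormedSpace.exp ((-2 : ℂ) • x₁)) =
      (1 - NormedSpace.exp ((-2 : ℂ) • x₁)) * (d₁ + (2 : ℂ) • 1) := by
    rw [← he₁, hd₁, ← map_one l₁, ← map_sub, ← map_mul, twistGen_mul_one_sub, ← map_smul,
      ← map_add, ← map_mul]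
  have hq₂ : d₂ * (1 - NormedSpace.exp ((-2 : ℂ) • x₂)) =
      (1 - NormedSpace.exp ((-2 : ℂ) • x₂)) * (d₂ + (2 : ℂ) • 1) := by
    rw [← he₂, hd₂, ← map_one l₂, ← map_sub, ← map_mul, twistGen_mul_one_sub, ← map_smul,
      ← map_add, ← map_mul]
  have key : NormedSpace.exp (d₁ * x₂) * jordanTwist h N₁ N₂ 1 =
      NormedSpace.exp (d₂ * x₁) * jordanTwist h N₁ N₂ (-1) := by
    refine eq_of_mul_basisProj_eq fun c => ?_
    set w₁ := weight N₁ c.1 with hw₁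
    set w₂ := weight N₂ c.2 with hw₂
    obtain ⟨Q, hQ₁, hQ₂⟩ := exists_exp_twist_mul_exp hn₁ hn₂ hxx hdx hdx' hq₁ hq₂ ((w₁ + w₂) / 2)
    have hP₁ : d₁ * (NormedSpace.exp ((-w₁ / 2) • x₁) * basisProj c) =
        w₁ • (NormedSpace.exp ((-w₁ / 2) • x₁) * basisProj c) := by
      rw [← leg_basisProj, ← he₁, hd₁, ← hl₁, ← hl₂, ← mul_assoc, ← mul_assoc, ← mul_assoc,
        ← map_mul, ← map_mul, ← map_mul, mul_assoc (twistGen h N₁),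
        twistGen_mul_Tpow_mul (J0_mul_basisProj c.1), map_smul, smul_mul_assoc]
    have hP₂ : d₂ * (NormedSpace.exp ((-w₂ / 2) • x₂) * basisProj c) =
        w₂ • (NormedSpace.exp ((-w₂ / 2) • x₂) * basisProj c) := by
      rw [← leg_basisProj, (commute_leg₁_leg₂ _ _).eq, ← he₂, hd₂, ← hl₁, ← hl₂, ← mul_assoc,
        ← mul_assoc, ← mul_assoc,
        ← map_mul, ← map_mul, ← map_mul, mul_assoc (twistGen h N₂),
        twistGen_mul_Tpow_mul (J0_mul_basisProj c.2), map_smul, smul_mul_assoc]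
    have hcomm : ∀ a b : ℂ, Commute (NormedSpace.exp (a • x₁)) (NormedSpace.exp (b • x₂)) :=
      fun a b => commute_exp (commute_exp ((hxx.smul_left a).smul_right b).symm
        (hn₁.smul a)).symm (hn₂.smul b)
    have hs₁ := exp_twist_mul_eigenvector hn₁ hn₂ hxx hdx hP₁ (-w₁ - w₂ / 2)
    have hs₂ := exp_twist_mul_eigenvector hn₂ hn₁ hxx.symm hdx' hP₂ (-w₂ - w₁ / 2)
    have hsplit : ∀ a b c : ℂ, NormedSpace.exp ((c + a) • x₁) * NormedSpace.exp ((c + b) • x₂) =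
        NormedSpace.exp (c • (x₁ + x₂)) *
          (NormedSpace.exp (a • x₁) * NormedSpace.exp (b • x₂)) := fun a b c => by
      rw [exp_smul_add hxx, exp_add_smul, exp_add_smul, mul_assoc, mul_assoc,
        ← mul_assoc (NormedSpace.exp (a • x₁)), (hcomm a c).eq, mul_assoc]
    rw [mul_assoc, mul_assoc, jordanTwist, jordanTwist, colTwist_mul_basisProj,
      colTwist_mul_basisProj, ← hl₁, ← hl₂, he₁, he₂, he₁, he₂, ← hw₁, ← hw₂]
    -- The common factor exp(((w₁+w₂)/2)(x₁+x₂)) is split off so that an eigenvector of d₁,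
    -- respectively d₂, remains. Both sides then become Q · T^(-w₁/2) ⊗ T^(-w₂/2) on the weight
    -- vector.
    have e1 : 1 * w₂ / 2 = (w₁ + w₂) / 2 + -w₁ / 2 := by ring
    have e2 : -(1 * w₁) / 2 = (w₁ + w₂) / 2 + (-w₁ - w₂ / 2) := by ring
    have e3 : -1 * w₂ / 2 = (w₁ + w₂) / 2 + (-w₂ - w₁ / 2) := by ring
    have e4 : -(-1 * w₁) / 2 = (w₁ + w₂) / 2 + -w₂ / 2 := by ring
    rw [e1, e2, e3, e4, hsplit, hsplit, mul_assoc (NormedSpace.exp (((w₁ + w₂) / 2) • (x₁ + x₂))),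
      ← mul_assoc, hQ₁, mul_assoc, hs₁, mul_assoc (NormedSpace.exp (((w₁ + w₂) / 2) • (x₁ + x₂))),
      ← mul_assoc (NormedSpace.exp (d₂ * x₁)), hQ₂, mul_assoc Q, (hcomm _ (-w₂ / 2)).eq, hs₂]
    rw [(hcomm (-w₁ / 2) _).eq]
    ring_nf
  have hR : Rh h N₁ N₂ = NormedSpace.exp (-(d₂ * x₁)) * NormedSpace.exp (d₁ * x₂) := by
    rw [Rh, hdx'.eq, hx₁, hx₂, hd₁, hd₂, leg₁_mul_leg₂, leg₁_mul_leg₂, Matrix.smul_kronecker,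
      Matrix.kronecker_smul]
    rfl
  have hu := (Matrix.isUnit_iff_isUnit_det _).1 (Matrix.isUnit_exp (d₂ * x₁))
  rw [hR, mul_assoc, key, Matrix.exp_neg, ← mul_assoc, Matrix.nonsing_inv_mul _ hu, one_mul]

theorem isUnit_Rh : IsUnit (Rh h N₁ N₂) := (Matrix.isUnit_exp _).mul (Matrix.isUnit_exp _)

theorem pow_apply_of_strict {N : ℕ} {A : Matrix (Fin (N + 1)) (Fin (N + 1)) ℂ}
    (hA : ∀ r c, c ≤ r → A r c = 0) (k : ℕ) (r c : Fin (N + 1)) (hrc : (c : ℕ) < r + k) :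
    (A ^ k) r c = 0 := by
  induction k generalizing c with
  | zero => rw [pow_zero, Matrix.one_apply_ne]; rintro rfl; simp at hrc
  | succ k ih =>
    rw [pow_succ, Matrix.mul_apply]
    refine Finset.sum_eq_zero fun s _ => ?_
    by_cases hs : (s : ℕ) < r + k
    · rw [ih s hs, zero_mul]
    · rw [hA s c (by rw [Fin.le_def]; omega), mul_zero]

theorem X_apply {N : ℕ} (r c : Fin (N + 1)) (hrc : c ≤ r) : X h N r c = 0 := by
  rw [X_eq_sum, Matrix.sum_apply]
  refine Finset.sum_eq_zero fun k _ => ?_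
  rw [Matrix.smul_apply, (isSuperdiagonal_Jplus N).pow_apply _ _ _ (by rw [Fin.le_def] at hrc; omega),
    smul_zero]

theorem Tpow_apply_of_le {N : ℕ} (a : ℂ) (r c : Fin (N + 1)) (hrc : c ≤ r) :
    Tpow h N a r c = if r = c then 1 else 0 := by
  have hs : ∀ r c : Fin (N + 1), c ≤ r → (a • (h • X h N)) r c = 0 := fun r c hrc => by
    simp [X_apply r c hrc]
  have hz : (a • (h • X h N)) ^ (N + 1) = 0 := by
    ext r c
    exact pow_apply_of_strict hs _ _ _ (by omega)
  rw [Tpow, exp_eq_sum_range hz, Finset.sum_range_succ', Matrix.add_apply, Matrix.sum_apply,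
    Finset.sum_eq_zero]
  · simp [Matrix.one_apply]
  · intro k _
    rw [Matrix.smul_apply, pow_apply_of_strict hs _ _ _ (by rw [Fin.le_def] at hrc; omega), smul_zero]

/-- In the lexicographic order of the pairs of indices the matrix is upper triangular with ones on
the diagonal. -/
theorem isUnit_jordanTwist (s : ℂ) : IsUnit (jordanTwist h N₁ N₂ s) := by
  rw [Matrix.isUnit_iff_isUnit_det,
    ← Matrix.det_submatrix_equiv_self (ofLex (α := Fin (N₁ + 1) × Fin (N₂ + 1)))]
  rw [Matrix.det_of_isUpperTriangular]
  · rw [Finset.prod_eq_one]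
    · exact isUnit_one
    · intro c _
      simp [jordanTwist, colTwist, Tpow_apply_of_le]
  · intro r c hrc
    have h1 := Prod.Lex.lt_iff.1 hrc
    change Tpow h N₁ _ (ofLex r).1 (ofLex c).1 * Tpow h N₂ _ (ofLex r).2 (ofLex c).2 = 0
    rcases h1 with h1 | ⟨h1, h2⟩
    · have h1' : (ofLex c).1 < (ofLex r).1 := h1
      rw [Tpow_apply_of_le _ _ _ h1'.le, if_neg h1'.ne', zero_mul]
    · have h2' : (ofLex c).2 < (ofLex r).2 := h2
      rw [Tpow_apply_of_le _ _ _ h2'.le, if_neg h2'.ne', mul_zero]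

end JordanTwist

/-! ### The intertwining property of the standard `R` matrix -/

section QExp

variable {ι : Type*} [Fintype ι] [DecidableEq ι]

theorem asymNum_succ {p : ℂ} (hp : p ≠ 1) (n : ℕ) : asymNum p (n + 1) = asymNum p n + p ^ n := by
  have h1 : (1 - p) ≠ 0 := sub_ne_zero.2 hp.symm
  rw [asymNum, asymNum]
  field_simp
  ring

theorem asymNum_succ' {p : ℂ} (hp : p ≠ 1) (n : ℕ) : asymNum p (n + 1) = 1 + p * asymNum p n := by
  have h1 : (1 - p) ≠ 0 := sub_ne_zero.2 hp.symm
  rw [asymNum, asymNum]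
  field_simp
  ring

/-- Each `U` that crosses `b` leaves c - a; moving every `c` to the left and every `a` to the right
costs powers of `p`, which add up to {n+1}_p. -/
theorem pow_mul_of_qCommutator {p : ℂ} (hp : p ≠ 1) {U a b c : Matrix ι ι ℂ}
    (ha : a * U = p • (U * a)) (hc : U * c = p • (c * U)) (hb : U * b = b * U + c - a) (n : ℕ) :
    U ^ (n + 1) * b = b * U ^ (n + 1) + asymNum p (n + 1) • (c * U ^ n - U ^ n * a) := by
  have ha' : ∀ n, a * U ^ n = p ^ n • (U ^ n * a) := fun n => by
    induction n with
    | zero => simp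
    | succ n ih =>
      rw [pow_succ', ← mul_assoc, ha, smul_mul_assoc, mul_assoc, ih, mul_smul_comm, smul_smul,
        mul_assoc, pow_succ']
  induction n with
  | zero =>
    have h1 : (1 - p) ≠ 0 := sub_ne_zero.2 hp.symm
    have : asymNum p 1 = 1 := by simp [asymNum, div_self h1]
    simp [hb, this, add_sub_assoc]
  | succ n ih =>
    rw [pow_succ' U (n + 1), mul_assoc, ih, mul_add, ← mul_assoc, hb, mul_smul_comm, mul_sub,
      ← mul_assoc U c, hc, ← mul_assoc U, ← pow_succ', smul_mul_assoc, mul_assoc c, ← pow_succ',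
      sub_mul, add_mul, ha' (n + 1), mul_assoc b, ← pow_succ', smul_sub, smul_sub, smul_smul,
      asymNum_succ' hp (n + 1)]
    have h2 := (asymNum_succ hp (n + 1)).symm.trans (asymNum_succ' hp (n + 1))
    have h3 : p ^ (n + 1) = 1 + p * asymNum p (n + 1) - asymNum p (n + 1) := by
      rw [← h2]; ring
    rw [h3]
    module

theorem asymFactorial_succ (p : ℂ) (n : ℕ) :
    asymFactorial p (n + 1) = asymFactorial p n * asymNum p (n + 1) := by
  rw [asymFactorial, asymFactorial, Finset.prod_range_succ]

theorem symFactorial_succ (p : ℂ) (n : ℕ) :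
    symFactorial p (n + 1) = symFactorial p n * symNum p (n + 1) := by
  rw [symFactorial, symFactorial, Finset.prod_range_succ]

theorem asymExp_mul_of_qCommutator {p : ℂ} (hp : p ≠ 1) {U a b c : Matrix ι ι ℂ}
    (ha : a * U = p • (U * a)) (hc : U * c = p • (c * U)) (hb : U * b = b * U + c - a) {L : ℕ}
    (hU : U ^ L = 0) (hL : ∀ n < L, asymNum p (n + 1) ≠ 0) :
    asymExp p U * (a + b) = (c + b) * asymExp p U := by
  have hU' : U ^ (L + 1) = 0 := by rw [pow_succ, hU, zero_mul]
  have h1 : asymExp p U = ∑ n ∈ Finset.range L, (asymFactorial p n)⁻¹ • U ^ n :=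
    tsum_smul_pow_eq_sum _ hU
  have h2 : asymExp p U = ∑ n ∈ Finset.range (L + 1), (asymFactorial p n)⁻¹ • U ^ n :=
    tsum_smul_pow_eq_sum _ hU'
  -- In the terms with `b` the index is shifted by one, so those sums are taken one term longer than
  -- the sums with `a` and `c`; {n+1}_p cancels against the factorial.
  have h3 : asymExp p U * b = b * asymExp p U + (c * asymExp p U - asymExp p U * a) := by
    conv_lhs => rw [h2]
    conv_rhs => enter [1]; rw [h2]
    rw [h1, Finset.sum_range_succ', Finset.mul_sum, Finset.sum_mul, ← Finset.sum_sub_distrib,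
      add_mul, mul_add, add_right_comm, Finset.sum_mul, Finset.mul_sum, ← Finset.sum_add_distrib]
    congr 1
    · refine Finset.sum_congr rfl fun n hn => ?_
      rw [smul_mul_assoc, pow_mul_of_qCommutator hp ha hc hb, smul_add, smul_smul,
        asymFactorial_succ, mul_inv, mul_assoc, inv_mul_cancel₀ (hL n (Finset.mem_range.1 hn)),
        mul_one, mul_smul_comm, mul_smul_comm, smul_mul_assoc, smul_sub]
    · simp
  rw [mul_add, h3, add_mul]
  abel

end QExp

/-! ### Powers of `q` in the weight and the relations of U_q(sl(2)) -/

section QWeights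

variable (q : ℂ) (N : ℕ)

/-- The diagonal matrix `q ^ (a J₀)`. -/
def weightPow (a : ℂ) : Matrix (Fin (N + 1)) (Fin (N + 1)) ℂ :=
  Matrix.diagonal fun i => Complex.exp (Complex.log q * (a * weight N i))

variable {q N}

theorem qPow_diagonal {ι : Type*} [Fintype ι] [DecidableEq ι] (d : ι → ℂ) :
    qPow q (Matrix.diagonal d) = Matrix.diagonal fun i => Complex.exp (Complex.log q * d i) := by
  rw [qPow, ← Matrix.diagonal_smul, Matrix.exp_diagonal]
  congr 1
  ext i
  rw [Pi.coe_exp, Complex.exp_eq_exp_ℂ]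
  rfl

theorem qPow_smul_J0 (a : ℂ) : qPow q (a • J0 N) = weightPow q N a := by
  rw [J0, ← Matrix.diagonal_smul, qPow_diagonal]
  rfl

theorem weightPow_zero : weightPow q N 0 = 1 := by
  simp [weightPow]

theorem weightPow_add (a b : ℂ) :
    weightPow q N (a + b) = weightPow q N a * weightPow q N b := by
  rw [weightPow, weightPow, weightPow, Matrix.diagonal_mul_diagonal]
  congr 1
  ext i
  rw [← Complex.exp_add]
  ring_nf

theorem weightPow_mul_neg (a : ℂ) : weightPow q N a * weightPow q N (-a) = 1 := by
  rw [← weightPow_add, add_neg_cancel, weightPow_zero]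

theorem weight_succ {r c : Fin (N + 1)} (h : (r : ℕ) + 1 = c) : weight N r = weight N c + 2 := by
  rw [weight, weight, ← h]
  push_cast
  ring

theorem IsSuperdiagonal.weightPow_mul {A : Matrix (Fin (N + 1)) (Fin (N + 1)) ℂ}
    (hA : IsSuperdiagonal A) (a : ℂ) :
    weightPow q N a * A = Complex.exp (Complex.log q * (2 * a)) • (A * weightPow q N a) := by
  rw [weightPow, ← mul_smul_comm, ← Matrix.diagonal_smul]
  refine hA.diagonal_mul fun r c h => ?_
  rw [weight_succ h, Pi.smul_apply, smul_eq_mul, ← Complex.exp_add]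
  ring_nf

theorem IsSuperdiagonal.weightPow_mul_pow {A : Matrix (Fin (N + 1)) (Fin (N + 1)) ℂ}
    (hA : IsSuperdiagonal A) (a : ℂ) (n : ℕ) :
    weightPow q N a * A ^ n =
      Complex.exp (Complex.log q * (2 * a)) ^ n • (A ^ n * weightPow q N a) := by
  induction n with
  | zero => simp
  | succ n ih =>
    rw [pow_succ, ← mul_assoc, ih, smul_mul_assoc, mul_assoc, hA.weightPow_mul, mul_smul_comm,
      smul_smul, ← mul_assoc (A ^ n), pow_succ]

theorem Jminus_mul_weightPow (a : ℂ) : Jminus N * weightPow q N a =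
    Complex.exp (Complex.log q * (2 * a)) • (weightPow q N a * Jminus N) := by
  ext r c
  rw [weightPow, Matrix.smul_apply, Matrix.mul_diagonal, Matrix.diagonal_mul, Jminus,
    Matrix.of_apply, smul_eq_mul]
  split_ifs with h
  · rw [weight_succ h.symm, one_mul, mul_one, ← Complex.exp_add]
    ring_nf
  · simp

theorem qJplus_mul_Jminus : qJplus q N * Jminus N =
    Matrix.diagonal fun i : Fin (N + 1) => symNum q (i + 1) * symNum q (N - i) := by
  ext r c
  rw [Matrix.mul_apply, Matrix.diagonal_apply]
  by_cases hc : (c : ℕ) < N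
  · rw [Finset.sum_eq_single ⟨c + 1, by omega⟩]
    · by_cases h : r = c
      · subst h; simp [qJplus, Jminus]
      · simp [qJplus, h, Fin.val_inj]
    · intro s _ hs
      have : (s : ℕ) ≠ c + 1 := fun h => hs (Fin.ext h)
      simp [Jminus, this]
    · simp
  -- On the lowest weight vector `Jminus` gives zero, and the formula agrees because it contains
  -- [0]_q.
  · have h0 : symNum q 0 = 0 := by simp [symNum]
    rw [Finset.sum_eq_zero]
    · split_ifs with h
      · subst h; rw [show N - (r : ℕ) = 0 by omega, h0, mul_zero]
      · rfl
    · intro s _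
      have : (s : ℕ) ≠ c + 1 := by omega
      simp [Jminus, this]

theorem Jminus_mul_qJplus : Jminus N * qJplus q N =
    Matrix.diagonal fun i : Fin (N + 1) => symNum q i * symNum q (N + 1 - i) := by
  ext r c
  rw [Matrix.mul_apply, Matrix.diagonal_apply]
  by_cases hc : 0 < (c : ℕ)
  · rw [Finset.sum_eq_single ⟨c - 1, by omega⟩]
    · have h1 : (c : ℕ) - 1 + 1 = c := by omega
      by_cases h : r = c
      · subst h; simp [qJplus, Jminus, h1]
      · simp [qJplus, Jminus, h1, h, Fin.val_inj]
    · intro s _ hs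
      have : (s : ℕ) + 1 ≠ c := fun h => hs (Fin.ext (by simp; omega))
      simp [qJplus, this]
    · simp
  · have h0 : symNum q 0 = 0 := by simp [symNum]
    rw [Finset.sum_eq_zero]
    · split_ifs with h
      · subst h; rw [show (r : ℕ) = 0 by omega, h0, zero_mul]
      · rfl
    · intro s _
      have : (s : ℕ) + 1 ≠ c := by omega
      simp [qJplus, this]

theorem qJplus_commutator (hq : q ≠ 0) (hq' : q - q⁻¹ ≠ 0) :
    (q - q⁻¹) • (qJplus q N * Jminus N - Jminus N * qJplus q N) =
      weightPow q N 1 - weightPow q N (-1) := by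
  rw [qJplus_mul_Jminus, Jminus_mul_qJplus, weightPow, weightPow, Matrix.diagonal_sub,
    Matrix.diagonal_sub, ← Matrix.diagonal_smul]
  congr 1
  ext i
  obtain ⟨j, hj⟩ : ∃ j, N = i + j := ⟨N - i, by omega⟩
  have h1 : weight N i = j - (i : ℕ) := by
    have hN : (N : ℂ) = ((i : ℕ) : ℂ) + j := by rw [← Nat.cast_add]; exact congrArg _ hj
    rw [weight, hN]
    ring
  have he : ∀ n : ℕ, Complex.exp (Complex.log q * n) = q ^ n := fun n => by
    rw [mul_comm, Complex.exp_nat_mul, Complex.exp_log hq]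
  have h2 : Complex.exp (Complex.log q * (1 * weight N i)) = q ^ j / q ^ (i : ℕ) := by
    rw [h1, one_mul, mul_sub, Complex.exp_sub, he, he]
  have h3 : Complex.exp (Complex.log q * (-1 * weight N i)) = q ^ (i : ℕ) / q ^ j := by
    rw [h1, neg_one_mul, neg_sub, mul_sub, Complex.exp_sub, he, he]
  have h4 : N - (i : ℕ) = j := by omega
  have h5 : N + 1 - (i : ℕ) = j + 1 := by omega
  rw [Pi.smul_apply, h2, h3, h4, h5, symNum, symNum, symNum, symNum, smul_eq_mul]
  have hi : q ^ (i : ℕ) ≠ 0 := pow_ne_zero _ hq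
  have hj' : q ^ j ≠ 0 := pow_ne_zero _ hq
  generalize hd : q - q⁻¹ = d at *
  rw [pow_succ, pow_succ]
  generalize q ^ (i : ℕ) = x at *
  generalize q ^ j = y at *
  field_simp
  rw [← hd]
  field_simp
  ring

end QWeights

/-! ### `R` intertwines the coproducts of `J₊` -/

section Intertwiner

variable {q : ℂ} {N₁ N₂ : ℕ}

/-- The coproduct of `J₊` for `s = 1`, the opposite coproduct for `s = -1`. -/
def coproduct (q : ℂ) (N₁ N₂ : ℕ) (s : ℂ) :
    Matrix (Fin (N₁ + 1) × Fin (N₂ + 1)) (Fin (N₁ + 1) × Fin (N₂ + 1)) ℂ :=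
  qJplus q N₁ ⊗ₖ weightPow q N₂ (s / 2) + weightPow q N₁ (-s / 2) ⊗ₖ qJplus q N₂

theorem exp_log_two_mul_half (hq : q ≠ 0) : Complex.exp (Complex.log q * (2 * (1 / 2))) = q := by
  rw [mul_one_div_cancel two_ne_zero, mul_one, Complex.exp_log hq]

theorem exp_log_two_mul_neg_half (hq : q ≠ 0) :
    Complex.exp (Complex.log q * (2 * (-1 / 2))) = q⁻¹ := by
  rw [show (2 * (-1 / 2) : ℂ) = -1 by norm_num, mul_neg_one, Complex.exp_neg, Complex.exp_log hq]

theorem exp_log_two_mul_neg_three_half (hq : q ≠ 0) :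
    Complex.exp (Complex.log q * (2 * (-3 / 2))) = (q ^ 3)⁻¹ := by
  rw [show (2 * (-3 / 2) : ℂ) = -((3 : ℕ) : ℂ) by norm_num, mul_neg, Complex.exp_neg, mul_comm,
    Complex.exp_nat_mul, Complex.exp_log hq]

/-- The exponent in the universal `R` matrix. -/
def rExponent (q : ℂ) (N₁ N₂ : ℕ) :
    Matrix (Fin (N₁ + 1) × Fin (N₂ + 1)) (Fin (N₁ + 1) × Fin (N₂ + 1)) ℂ :=
  (1 - (q ^ 2)⁻¹) • ((weightPow q N₁ (1 / 2) * qJplus q N₁) ⊗ₖ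
    (weightPow q N₂ (-1 / 2) * Jminus N₂))

/-- The Cartan part of the universal `R` matrix. -/
def rCartan (q : ℂ) (N₁ N₂ : ℕ) :
    Matrix (Fin (N₁ + 1) × Fin (N₂ + 1)) (Fin (N₁ + 1) × Fin (N₂ + 1)) ℂ :=
  Matrix.diagonal fun c => Complex.exp (Complex.log q * (1 / 2 * (weight N₁ c.1 * weight N₂ c.2)))

theorem Rq_eq : Rq q N₁ N₂ = rCartan q N₁ N₂ * asymExp ((q ^ 2)⁻¹) (rExponent q N₁ N₂) := by
  rw [Rq, ← neg_smul, qPow_smul_J0, qPow_smul_J0, rExponent, neg_div]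
  congr 1
  rw [J0, J0, Matrix.diagonal_kronecker_diagonal, ← Matrix.diagonal_smul, qPow_diagonal]
  rfl

theorem rExponent_pow : rExponent q N₁ N₂ ^ (N₁ + 1) = 0 := by
  have h1 : IsSuperdiagonal (weightPow q N₁ (1 / 2) * qJplus q N₁) := fun r c hrc => by
    rw [weightPow, Matrix.diagonal_mul, isSuperdiagonal_qJplus q N₁ r c hrc, mul_zero]
  rw [rExponent, smul_pow, ← leg₁_mul_leg₂, (commute_leg₁_leg₂ _ _).mul_pow, ← map_pow,
    h1.pow_eq_zero, map_zero, zero_mul, smul_zero]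

theorem rCartan_mul_left {A : Matrix (Fin (N₁ + 1)) (Fin (N₁ + 1)) ℂ} (hA : IsSuperdiagonal A)
    (a : ℂ) : rCartan q N₁ N₂ * (A ⊗ₖ weightPow q N₂ a) =
      (A ⊗ₖ weightPow q N₂ (a + 1)) * rCartan q N₁ N₂ := by
  ext r c
  rw [rCartan, Matrix.diagonal_mul, Matrix.mul_diagonal, Matrix.kronecker_apply,
    Matrix.kronecker_apply, weightPow, weightPow, Matrix.diagonal_apply, Matrix.diagonal_apply]
  by_cases h1 : (r.1 : ℕ) + 1 = c.1
  · by_cases h2 : r.2 = c.2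
    · rw [if_pos h2, if_pos h2, weight_succ h1, h2, mul_left_comm, mul_assoc, ← Complex.exp_add,
        ← Complex.exp_add]
      ring_nf
    · simp [h2]
  · simp [hA _ _ h1]

theorem rCartan_mul_right {A : Matrix (Fin (N₂ + 1)) (Fin (N₂ + 1)) ℂ} (hA : IsSuperdiagonal A)
    (a : ℂ) : rCartan q N₁ N₂ * (weightPow q N₁ a ⊗ₖ A) =
      (weightPow q N₁ (a + 1) ⊗ₖ A) * rCartan q N₁ N₂ := by
  ext r c
  rw [rCartan, Matrix.diagonal_mul, Matrix.mul_diagonal, Matrix.kronecker_apply,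
    Matrix.kronecker_apply, weightPow, weightPow, Matrix.diagonal_apply, Matrix.diagonal_apply]
  by_cases h1 : (r.2 : ℕ) + 1 = c.2
  · by_cases h2 : r.1 = c.1
    · have h3 : Complex.exp (Complex.log q * (1 / 2 * (weight N₁ c.1 * (weight N₂ c.2 + 2)))) *
          Complex.exp (Complex.log q * (a * weight N₁ c.1)) =
          Complex.exp (Complex.log q * ((a + 1) * weight N₁ c.1)) *
          Complex.exp (Complex.log q * (1 / 2 * (weight N₁ c.1 * weight N₂ c.2))) := by
        rw [← Complex.exp_add, ← Complex.exp_add]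
        ring_nf
      rw [if_pos h2, if_pos h2, weight_succ h1, h2]
      linear_combination (A r.2 c.2) * h3
    · simp [h2]
  · simp [hA _ _ h1]

theorem kronecker_sub {m n : Type*} (A : Matrix m m ℂ) (B C : Matrix n n ℂ) :
    A ⊗ₖ (B - C) = A ⊗ₖ B - A ⊗ₖ C := by
  ext
  simp [mul_sub]

/-- The universal `R` matrix intertwines the coproduct of `J₊` with the opposite one. -/
theorem Rq_mul_coproduct (hq : q ≠ 0) (hq2 : q ^ 2 ≠ 1)
    (hN : ∀ n < N₁ + 1, asymNum ((q ^ 2)⁻¹) (n + 1) ≠ 0) :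
    Rq q N₁ N₂ * coproduct q N₁ N₂ 1 = coproduct q N₁ N₂ (-1) * Rq q N₁ N₂ := by
  have hp : (q ^ 2)⁻¹ ≠ 1 := fun h => hq2 (by rw [← inv_inv (q ^ 2), h, inv_one])
  have hq' : q - q⁻¹ ≠ 0 := fun h => hq2 (by field_simp at h; linear_combination h)
  have hJ₁ := isSuperdiagonal_qJplus q N₁
  have hJ₂ := isSuperdiagonal_qJplus q N₂
  have hEJ : weightPow q N₁ (1 / 2) * qJplus q N₁ = q • (qJplus q N₁ * weightPow q N₁ (1 / 2)) := by
    rw [hJ₁.weightPow_mul, exp_log_two_mul_half hq]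
  have hkk : ∀ (N : ℕ) (a b c : ℂ), a + b = c →
      weightPow q N a * weightPow q N b = weightPow q N c := fun N a b c h => by
    rw [← weightPow_add, h]
  have f1 : weightPow q N₁ (1 / 2) * qJplus q N₁ * qJplus q N₁ =
      q • (qJplus q N₁ * (weightPow q N₁ (1 / 2) * qJplus q N₁)) := by
    rw [hEJ, smul_mul_assoc, mul_assoc, hEJ]
  have f2 : weightPow q N₂ (-1 / 2) * Jminus N₂ * weightPow q N₂ (1 / 2) =
      q • (weightPow q N₂ (1 / 2) * (weightPow q N₂ (-1 / 2) * Jminus N₂)) := by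
    rw [mul_assoc, Jminus_mul_weightPow, exp_log_two_mul_half hq, mul_smul_comm, ← mul_assoc,
      ← mul_assoc, ← weightPow_add, ← weightPow_add, add_comm (-1 / 2 : ℂ)]
  have f3 : weightPow q N₂ (-1 / 2) * Jminus N₂ * weightPow q N₂ (-3 / 2) =
      (q ^ 3)⁻¹ • (weightPow q N₂ (-3 / 2) * (weightPow q N₂ (-1 / 2) * Jminus N₂)) := by
    rw [mul_assoc, Jminus_mul_weightPow, exp_log_two_mul_neg_three_half hq, mul_smul_comm,
      ← mul_assoc, ← mul_assoc, ← weightPow_add, ← weightPow_add, add_comm (-1 / 2 : ℂ)]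
  have f5 : weightPow q N₁ (-1 / 2) * (weightPow q N₁ (1 / 2) * qJplus q N₁) = qJplus q N₁ := by
    rw [← mul_assoc, hkk _ _ _ 0 (by norm_num), weightPow_zero, one_mul]
  have f4 : weightPow q N₁ (1 / 2) * qJplus q N₁ * weightPow q N₁ (-1 / 2) = q • qJplus q N₁ := by
    rw [hEJ, smul_mul_assoc, mul_assoc, hkk _ _ _ 0 (by norm_num), weightPow_zero, mul_one]
  -- This is the relation for [J₊, J₋], dressed with q^(-J₀/2); it supplies the difference c - a.
  have f6 : (1 - (q ^ 2)⁻¹) • (q • (weightPow q N₂ (-1 / 2) * Jminus N₂ * qJplus q N₂) -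
      qJplus q N₂ * (weightPow q N₂ (-1 / 2) * Jminus N₂)) =
      weightPow q N₂ (-3 / 2) - weightPow q N₂ (1 / 2) := by
    have g1 : qJplus q N₂ * weightPow q N₂ (-1 / 2) =
        q • (weightPow q N₂ (-1 / 2) * qJplus q N₂) := by
      rw [hJ₂.weightPow_mul, exp_log_two_mul_neg_half hq, smul_smul, mul_inv_cancel₀ hq, one_smul]
    have g2 : (1 - (q ^ 2)⁻¹) * q = q - q⁻¹ := by field_simp
    rw [← mul_assoc, g1, smul_mul_assoc, ← smul_sub, smul_smul, g2, mul_assoc, mul_assoc, ← mul_sub,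
      ← neg_sub (qJplus q N₂ * Jminus N₂), mul_neg, smul_neg, ← mul_smul_comm,
      qJplus_commutator hq hq', mul_sub, hkk _ _ _ (1 / 2) (by norm_num),
      hkk _ _ _ (-3 / 2) (by norm_num), neg_sub]
  -- The `q`-exponential changes only the first summand, from exponent 1/2 to -3/2. The Cartan part
  -- then raises both exponents by 1, to -1/2 and 1/2, as in the opposite coproduct.
  have h0 := asymExp_mul_of_qCommutator (U := rExponent q N₁ N₂) hp
    (a := qJplus q N₁ ⊗ₖ weightPow q N₂ (1 / 2))
    (b := weightPow q N₁ (-1 / 2) ⊗ₖ qJplus q N₂)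
    (c := qJplus q N₁ ⊗ₖ weightPow q N₂ (-3 / 2)) ?_ ?_ ?_ rExponent_pow hN
  · rw [Rq_eq, coproduct, mul_assoc, h0, coproduct, ← mul_assoc, ← mul_assoc, mul_add,
      rCartan_mul_left hJ₁, rCartan_mul_right hJ₂, ← add_mul]
    norm_num
  · rw [rExponent, mul_smul_comm, smul_mul_assoc, ← Matrix.mul_kronecker_mul,
      ← Matrix.mul_kronecker_mul, f2, f1, Matrix.kronecker_smul, Matrix.smul_kronecker,
      smul_smul, smul_smul, smul_smul]
    congr 1
    field_simp
  · rw [rExponent, mul_smul_comm, smul_mul_assoc, ← Matrix.mul_kronecker_mul,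
      ← Matrix.mul_kronecker_mul, f3, f1, Matrix.kronecker_smul, Matrix.smul_kronecker,
      smul_smul, smul_smul, smul_smul]
    congr 1
    field_simp
  · rw [rExponent, mul_smul_comm, smul_mul_assoc, ← Matrix.mul_kronecker_mul,
      ← Matrix.mul_kronecker_mul, f4, f5, add_sub_assoc, ← kronecker_sub, ← f6,
      Matrix.kronecker_smul, kronecker_sub, Matrix.kronecker_smul, Matrix.smul_kronecker,
      smul_sub]
    abel

/-! ### `q`-binomial expansion of the `q`-exponential of the coproduct -/

theorem symNum_add (hq : q ≠ 0) {σ : ℂ} (hσ : σ = q ∨ σ = q⁻¹) (m l : ℕ) :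
    σ ^ l * symNum q m + σ⁻¹ ^ m * symNum q l = symNum q (m + l) := by
  rw [symNum, symNum, symNum, pow_add]
  have hm : q ^ m ≠ 0 := pow_ne_zero _ hq
  have hl : q ^ l ≠ 0 := pow_ne_zero _ hq
  rcases hσ with rfl | rfl
  · rw [inv_pow]
    field_simp
    ring
  · rw [inv_inv, inv_pow]
    field_simp
    ring

/-- The normal ordered terms of the `q`-exponential of the coproduct. -/
def coproductTerm (q : ℂ) (N₁ N₂ : ℕ) (s : ℂ) (m l : ℕ) :
    Matrix (Fin (N₁ + 1) × Fin (N₂ + 1)) (Fin (N₁ + 1) × Fin (N₂ + 1)) ℂ :=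
  ((symFactorial q m)⁻¹ * (symFactorial q l)⁻¹) •
    ((qJplus q N₁ ^ m * weightPow q N₁ (-(s * l) / 2)) ⊗ₖ
      (qJplus q N₂ ^ l * weightPow q N₂ (s * m / 2)))

theorem coproduct_mul_coproductTerm {s σ : ℂ} (hs : Complex.exp (Complex.log q * s) = σ) {m l : ℕ}
    (hm : symNum q (m + 1) ≠ 0) (hl : symNum q (l + 1) ≠ 0) :
    coproduct q N₁ N₂ s * coproductTerm q N₁ N₂ s m l =
      (σ ^ l * symNum q (m + 1)) • coproductTerm q N₁ N₂ s (m + 1) l +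
      (σ⁻¹ ^ m * symNum q (l + 1)) • coproductTerm q N₁ N₂ s m (l + 1) := by
  have e1 : Complex.exp (Complex.log q * (2 * (s / 2))) = σ := by
    rw [mul_div_cancel₀ _ two_ne_zero, hs]
  have e2 : Complex.exp (Complex.log q * (2 * (-s / 2))) = σ⁻¹ := by
    rw [mul_div_cancel₀ _ two_ne_zero, mul_neg, Complex.exp_neg, hs]
  have a1 : s / 2 + s * m / 2 = s * ((m + 1 : ℕ) : ℂ) / 2 := by push_cast; ring
  have a2 : -s / 2 + -(s * l) / 2 = -(s * ((l + 1 : ℕ) : ℂ)) / 2 := by push_cast; ring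
  rw [coproduct, add_mul, coproductTerm, coproductTerm, coproductTerm, mul_smul_comm, mul_smul_comm,
    ← Matrix.mul_kronecker_mul, ← Matrix.mul_kronecker_mul, ← mul_assoc (weightPow q N₂ (s / 2)),
    (isSuperdiagonal_qJplus q N₂).weightPow_mul_pow, e1, ← mul_assoc (weightPow q N₁ (-s / 2)),
    (isSuperdiagonal_qJplus q N₁).weightPow_mul_pow, e2, smul_mul_assoc, smul_mul_assoc,
    mul_assoc _ (weightPow q N₂ (s / 2)), mul_assoc _ (weightPow q N₁ (-s / 2)), ← weightPow_add,
    ← weightPow_add, a1, a2, ← mul_assoc (qJplus q N₁), ← mul_assoc (qJplus q N₂), ← pow_succ',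
    ← pow_succ', Matrix.kronecker_smul, Matrix.smul_kronecker, smul_smul, smul_smul, smul_smul,
    smul_smul, symFactorial_succ, symFactorial_succ]
  congr 2
  · field_simp
  · field_simp

/-- The `n`-th `q`-divided power of the coproduct. -/
def coproductDivPow (q : ℂ) (N₁ N₂ : ℕ) (s : ℂ) (n : ℕ) :
    Matrix (Fin (N₁ + 1) × Fin (N₂ + 1)) (Fin (N₁ + 1) × Fin (N₂ + 1)) ℂ :=
  ∑ p ∈ Finset.HasAntidiagonal.antidiagonal n, coproductTerm q N₁ N₂ s p.1 p.2

theorem coproductDivPow_zero (s : ℂ) : coproductDivPow q N₁ N₂ s 0 = 1 := by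
  simp [coproductDivPow, coproductTerm, symFactorial, weightPow_zero]

/-- A `q`-Pascal rule: the term (m, l) of degree n+1 arises from (m-1, l) and (m, l-1), with total
coefficient σˡ[m] + σ⁻ᵐ[l] = [m+l]. -/
theorem coproduct_mul_coproductDivPow (hq : q ≠ 0) {s σ : ℂ}
    (hs : Complex.exp (Complex.log q * s) = σ) (hσ : σ = q ∨ σ = q⁻¹) {n : ℕ}
    (hn : ∀ k ≤ n, symNum q (k + 1) ≠ 0) :
    coproduct q N₁ N₂ s * coproductDivPow q N₁ N₂ s n =
      symNum q (n + 1) • coproductDivPow q N₁ N₂ s (n + 1) := by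
  have h0 : symNum q 0 = 0 := by simp [symNum]
  have h1 : ∑ p ∈ Finset.HasAntidiagonal.antidiagonal (n + 1),
      (σ ^ p.2 * symNum q p.1) • coproductTerm q N₁ N₂ s p.1 p.2 =
      ∑ p ∈ Finset.HasAntidiagonal.antidiagonal n,
        (σ ^ p.2 * symNum q (p.1 + 1)) • coproductTerm q N₁ N₂ s (p.1 + 1) p.2 := by
    rw [Finset.Nat.sum_antidiagonal_succ]
    simp [h0]
  have h2 : ∑ p ∈ Finset.HasAntidiagonal.antidiagonal (n + 1),
      (σ⁻¹ ^ p.1 * symNum q p.2) • coproductTerm q N₁ N₂ s p.1 p.2 =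
      ∑ p ∈ Finset.HasAntidiagonal.antidiagonal n,
        (σ⁻¹ ^ p.1 * symNum q (p.2 + 1)) • coproductTerm q N₁ N₂ s p.1 (p.2 + 1) := by
    rw [Finset.Nat.sum_antidiagonal_succ']
    simp [h0]
  calc coproduct q N₁ N₂ s * coproductDivPow q N₁ N₂ s n
      = ∑ p ∈ Finset.HasAntidiagonal.antidiagonal n,
          ((σ ^ p.2 * symNum q (p.1 + 1)) • coproductTerm q N₁ N₂ s (p.1 + 1) p.2 +
          (σ⁻¹ ^ p.1 * symNum q (p.2 + 1)) • coproductTerm q N₁ N₂ s p.1 (p.2 + 1)) := by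
        rw [coproductDivPow, Finset.mul_sum]
        refine Finset.sum_congr rfl fun p hp => ?_
        rw [Finset.HasAntidiagonal.mem_antidiagonal] at hp
        exact coproduct_mul_coproductTerm hs (hn _ (by omega)) (hn _ (by omega))
    _ = ∑ p ∈ Finset.HasAntidiagonal.antidiagonal (n + 1),
          (σ ^ p.2 * symNum q p.1 + σ⁻¹ ^ p.1 * symNum q p.2) •
            coproductTerm q N₁ N₂ s p.1 p.2 := by
        simp only [add_smul, Finset.sum_add_distrib]
        rw [h1, h2]
    _ = symNum q (n + 1) • coproductDivPow q N₁ N₂ s (n + 1) := by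
        rw [coproductDivPow, Finset.smul_sum]
        refine Finset.sum_congr rfl fun p hp => ?_
        rw [symNum_add hq hσ, Finset.HasAntidiagonal.mem_antidiagonal.1 hp]

theorem mul_coproductDivPow_of_intertwine (hq : q ≠ 0)
    {R : Matrix (Fin (N₁ + 1) × Fin (N₂ + 1)) (Fin (N₁ + 1) × Fin (N₂ + 1)) ℂ}
    (hR : R * coproduct q N₁ N₂ 1 = coproduct q N₁ N₂ (-1) * R) {n : ℕ}
    (hn : ∀ k < n, symNum q (k + 1) ≠ 0) :
    R * coproductDivPow q N₁ N₂ 1 n = coproductDivPow q N₁ N₂ (-1) n * R := by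
  induction n with
  | zero => simp [coproductDivPow_zero]
  | succ n ih =>
    have h1 := coproduct_mul_coproductDivPow (N₁ := N₁) (N₂ := N₂) (s := 1) (σ := q) (n := n) hq
      (by rw [mul_one, Complex.exp_log hq]) (Or.inl rfl) (fun k hk => hn k (by omega))
    have h2 := coproduct_mul_coproductDivPow (N₁ := N₁) (N₂ := N₂) (s := -1) (σ := q⁻¹) (n := n) hq
      (by rw [mul_neg_one, Complex.exp_neg, Complex.exp_log hq]) (Or.inr rfl)
      (fun k hk => hn k (by omega))
    have h3 : symNum q (n + 1) • (R * coproductDivPow q N₁ N₂ 1 (n + 1)) =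
        symNum q (n + 1) • (coproductDivPow q N₁ N₂ (-1) (n + 1) * R) := by
      rw [← mul_smul_comm, ← h1, ← mul_assoc, hR, mul_assoc, ih fun k hk => hn k (by omega),
        ← mul_assoc, h2, smul_mul_assoc]
    exact smul_right_injective _ (hn n (Nat.lt_succ_self n)) h3

theorem sum_antidiagonal_eq_sum_range {A B : ℕ} {V : Type*} [AddCommMonoid V] (F : ℕ → ℕ → V)
    (hA : ∀ m l, A ≤ m → F m l = 0) (hB : ∀ m l, B ≤ l → F m l = 0) :
    ∑ n ∈ Finset.range (A + B), ∑ p ∈ Finset.HasAntidiagonal.antidiagonal n, F p.1 p.2 =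
      ∑ m ∈ Finset.range A, ∑ l ∈ Finset.range B, F m l := by
  rw [← Finset.sum_product', ← Finset.sum_fiberwise_of_maps_to (t := Finset.range (A + B))
    (g := fun p : ℕ × ℕ => p.1 + p.2)]
  · refine Finset.sum_congr rfl fun n _ => (Finset.sum_subset ?_ ?_).symm
    · intro p hp
      simpa using (Finset.mem_filter.1 hp).2
    · intro p hp hp'
      rw [Finset.HasAntidiagonal.mem_antidiagonal] at hp
      by_cases h1 : p.1 < A
      · refine hB _ _ ?_
        by_contra h2
        exact hp' (by simp [h1, hp, not_le.1 h2])
      · exact hA _ _ (not_lt.1 h1)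
  · intro p hp
    simp only [Finset.mem_product, Finset.mem_range] at hp ⊢
    omega

/-- The `q`-exponential of `J₊`, with the argument dilated by `q ^ a`. -/
def dilatedExp (η q : ℂ) (N : ℕ) (a : ℂ) : Matrix (Fin (N + 1)) (Fin (N + 1)) ℂ :=
  ∑ n ∈ Finset.range (N + 1),
    (η ^ n * Complex.exp (Complex.log q * (a * n)) * (symFactorial q n)⁻¹) • qJplus q N ^ n

/-- The `q`-exponential of the coproduct acts on weight vectors as a product of two
`q`-exponentials. -/
theorem sum_coproductDivPow (η s : ℂ) :
    ∑ n ∈ Finset.range ((N₁ + 1) + (N₂ + 1)), η ^ n • coproductDivPow q N₁ N₂ s n =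
      colTwist (fun j => dilatedExp η q N₁ (s * weight N₂ j / 2))
        (fun i => dilatedExp η q N₂ (-(s * weight N₁ i) / 2)) := by
  have h1 : ∀ n, η ^ n • coproductDivPow q N₁ N₂ s n = ∑ p ∈ Finset.HasAntidiagonal.antidiagonal n,
      (η ^ p.1 * η ^ p.2) • coproductTerm q N₁ N₂ s p.1 p.2 := fun n => by
    rw [coproductDivPow, Finset.smul_sum]
    refine Finset.sum_congr rfl fun p hp => ?_
    rw [← pow_add, Finset.HasAntidiagonal.mem_antidiagonal.1 hp]
  simp only [h1]
  rw [sum_antidiagonal_eq_sum_range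
    (fun m l => (η ^ m * η ^ l) • coproductTerm q N₁ N₂ s m l)]
  · ext r c
    rw [colTwist, Matrix.of_apply, dilatedExp, dilatedExp]
    simp only [Matrix.sum_apply]
    rw [Finset.sum_mul_sum]
    refine Finset.sum_congr rfl fun m _ => Finset.sum_congr rfl fun l _ => ?_
    rw [coproductTerm, Matrix.smul_apply, Matrix.smul_apply, Matrix.smul_apply, Matrix.smul_apply,
      Matrix.kronecker_apply, weightPow, weightPow, Matrix.mul_diagonal, Matrix.mul_diagonal]
    simp only [smul_eq_mul]
    -- On a weight vector the powers of q^(J₀) are scalars. The one on the first leg depends on the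
    -- degree `l` in the second, so it dilates the second leg, and conversely.
    rw [show -(s * weight N₁ c.1) / 2 * l = -(s * l) / 2 * weight N₁ c.1 by ring,
      show s * weight N₂ c.2 / 2 * m = s * m / 2 * weight N₂ c.2 by ring]
    ring
  · intro m l hm
    rw [coproductTerm, pow_eq_zero_of_le hm (isSuperdiagonal_qJplus q N₁).pow_eq_zero, zero_mul,
      Matrix.zero_kronecker, smul_zero, smul_zero]
  · intro m l hl
    rw [coproductTerm, pow_eq_zero_of_le hl (isSuperdiagonal_qJplus q N₂).pow_eq_zero, zero_mul,
      Matrix.kronecker_zero, smul_zero, smul_zero]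

end Intertwiner

/-! ### Limits `q → 1` in one leg -/

section Limits

theorem tendsto_id_nhdsNE : Tendsto (fun q : ℂ => q) (𝓝[≠] 1) (𝓝 1) :=
  tendsto_id.mono_left nhdsWithin_le_nhds

theorem eventually_ne_zero : ∀ᶠ q : ℂ in 𝓝[≠] 1, q ≠ 0 :=
  tendsto_id_nhdsNE.eventually_ne one_ne_zero

theorem eventually_sq_ne_one : ∀ᶠ q : ℂ in 𝓝[≠] 1, q ^ 2 ≠ 1 := by
  have h1 : ∀ᶠ q : ℂ in 𝓝[≠] 1, q ≠ -1 :=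
    tendsto_id_nhdsNE.eventually_ne (by norm_num)
  filter_upwards [h1, self_mem_nhdsWithin] with q h1 h2 h3
  rcases eq_or_eq_neg_of_sq_eq_sq q 1 (by rw [h3, one_pow]) with h | h
  · exact h2 h
  · exact h1 h

theorem sub_inv_ne_zero {q : ℂ} (hq : q ≠ 0) (hq2 : q ^ 2 ≠ 1) : q - q⁻¹ ≠ 0 := fun h =>
  hq2 (by field_simp at h; linear_combination h)

theorem symNum_eq_sum {q : ℂ} (hq : q ≠ 0) (hq2 : q ^ 2 ≠ 1) (n : ℕ) :
    symNum q n = q * (q ^ n)⁻¹ * ∑ k ∈ Finset.range n, (q ^ 2) ^ k := by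
  have h1 := geom_sum_eq hq2 n
  have h2 : q ^ 2 - 1 ≠ 0 := sub_ne_zero.2 hq2
  have h3 := sub_inv_ne_zero hq hq2
  have h4 : q ^ n ≠ 0 := pow_ne_zero _ hq
  rw [h1, symNum, ← pow_mul, mul_comm 2 n, pow_mul, div_eq_iff h3]
  field_simp

theorem tendsto_symNum (n : ℕ) : Tendsto (fun q => symNum q n) (𝓝[≠] 1) (𝓝 n) := by
  have h1 : Tendsto (fun q : ℂ => q * (q ^ n)⁻¹ * ∑ k ∈ Finset.range n, (q ^ 2) ^ k) (𝓝[≠] 1)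
      (𝓝 (1 * (1 ^ n)⁻¹ * ∑ k ∈ Finset.range n, (1 ^ 2) ^ k)) := by
    refine (tendsto_id_nhdsNE.mul ((tendsto_id_nhdsNE.pow n).inv₀ (by simp))).mul ?_
    exact tendsto_finsetSum _ fun k _ => (tendsto_id_nhdsNE.pow 2).pow k
  simp only [one_pow, inv_one, mul_one, Finset.sum_const, Finset.card_range, nsmul_eq_mul,
    one_mul] at h1
  refine h1.congr' ?_
  filter_upwards [eventually_ne_zero, eventually_sq_ne_one] with q hq hq2
  rw [symNum_eq_sum hq hq2]

theorem eventually_symNum_ne_zero (n : ℕ) : ∀ᶠ q in 𝓝[≠] 1, symNum q (n + 1) ≠ 0 :=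
  (tendsto_symNum (n + 1)).eventually_ne (by exact_mod_cast n.succ_ne_zero)

theorem eventually_forall_symNum_ne_zero (K : ℕ) :
    ∀ᶠ q in 𝓝[≠] 1, ∀ n < K, symNum q (n + 1) ≠ 0 := by
  have := (Filter.eventually_all_finset (Finset.range K)).2
    fun n _ => eventually_symNum_ne_zero n
  filter_upwards [this] with q hq n hn using hq n (Finset.mem_range.2 hn)

theorem tendsto_asymNum (n : ℕ) :
    Tendsto (fun q : ℂ => asymNum ((q ^ 2)⁻¹) n) (𝓝[≠] 1) (𝓝 n) := by
  have h1 : Tendsto (fun q : ℂ => ∑ k ∈ Finset.range n, ((q ^ 2)⁻¹) ^ k) (𝓝[≠] 1)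
      (𝓝 (∑ k ∈ Finset.range n, ((1 ^ 2)⁻¹) ^ k)) :=
    tendsto_finsetSum _ fun k _ => ((tendsto_id_nhdsNE.pow 2).inv₀ (by simp)).pow k
  simp only [one_pow, inv_one, Finset.sum_const, Finset.card_range, nsmul_eq_mul, mul_one] at h1
  refine h1.congr' ?_
  filter_upwards [eventually_sq_ne_one] with q hq2
  have hp : (q ^ 2)⁻¹ ≠ 1 := fun h => hq2 (by rw [← inv_inv (q ^ 2), h, inv_one])
  rw [geom_sum_eq hp, asymNum, ← neg_div_neg_eq, neg_sub, neg_sub]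

theorem eventually_forall_asymNum_ne_zero (K : ℕ) :
    ∀ᶠ q : ℂ in 𝓝[≠] 1, ∀ n < K, asymNum ((q ^ 2)⁻¹) (n + 1) ≠ 0 := by
  have := (Filter.eventually_all_finset (l := 𝓝[≠] (1 : ℂ)) (Finset.range K)).2
    fun n _ => (tendsto_asymNum (n + 1)).eventually_ne (Nat.cast_ne_zero.2 n.succ_ne_zero)
  filter_upwards [this] with q hq n hn using hq n (Finset.mem_range.2 hn)

theorem tendsto_asymFactorial_inv (n : ℕ) :
    ∃ L, Tendsto (fun q : ℂ => (asymFactorial ((q ^ 2)⁻¹) n)⁻¹) (𝓝[≠] 1) (𝓝 L) := by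
  refine ⟨_, Tendsto.inv₀ (tendsto_finsetProd _ fun k _ => tendsto_asymNum (k + 1)) ?_⟩
  exact Finset.prod_ne_zero_iff.2 fun k _ => by exact_mod_cast k.succ_ne_zero

theorem tendsto_exp_log (a : ℂ) :
    Tendsto (fun q : ℂ => Complex.exp (Complex.log q * a)) (𝓝[≠] 1) (𝓝 1) := by
  have h1 : Tendsto (fun q : ℂ => Complex.exp (Complex.log q * a)) (𝓝 1)
      (𝓝 (Complex.exp (Complex.log 1 * a))) :=
    (Complex.continuous_exp.tendsto _).comp
      ((continuousAt_clog Complex.one_mem_slitPlane).tendsto.mul_const a)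
  rw [Complex.log_one, zero_mul, Complex.exp_zero] at h1
  exact h1.mono_left nhdsWithin_le_nhds

theorem tendsto_diagonal_exp_log {ι : Type*} [DecidableEq ι] (d : ι → ℂ) :
    Tendsto (fun q : ℂ => Matrix.diagonal fun i => Complex.exp (Complex.log q * d i)) (𝓝[≠] 1)
      (𝓝 (1 : Matrix ι ι ℂ)) := by
  rw [← Matrix.diagonal_one]
  refine ((continuous_id.matrix_diagonal).tendsto (fun _ : ι => (1 : ℂ))).comp ?_
  exact tendsto_pi_nhds.2 fun i => tendsto_exp_log (d i)

theorem tendsto_weightPow (N : ℕ) (a : ℂ) :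
    Tendsto (fun q => weightPow q N a) (𝓝[≠] 1) (𝓝 1) := tendsto_diagonal_exp_log _

theorem tendsto_qJplus (N : ℕ) : Tendsto (fun q => qJplus q N) (𝓝[≠] 1) (𝓝 (Jplus N)) := by
  refine tendsto_pi_nhds.2 fun r => tendsto_pi_nhds.2 fun c => ?_
  simp only [qJplus, Jplus, Matrix.of_apply]
  split_ifs
  · exact (tendsto_symNum _).mul (tendsto_symNum _)
  · exact tendsto_const_nhds

theorem tendsto_matrix_inv {α ι : Type*} [Fintype ι] [DecidableEq ι] {l : Filter α}
    {A : α → Matrix ι ι ℂ} {B : Matrix ι ι ℂ} (hA : Tendsto A l (𝓝 B)) (hB : IsUnit B) :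
    Tendsto (fun x => (A x)⁻¹) l (𝓝 B⁻¹) := by
  have hd : B.det ≠ 0 := ((Matrix.isUnit_iff_isUnit_det _).1 hB).ne_zero
  simp only [Matrix.inv_def, Ring.inverse_eq_inv']
  exact (((continuous_id.matrix_det.tendsto B).comp hA).inv₀ hd).smul
    ((continuous_id.matrix_adjugate.tendsto B).comp hA)

/-- If `a(x) a(ρ x)` has convergent coefficients, recursively in those of `a`, so has `a`. -/
theorem exists_tendsto_coeff_of_mul_rescale {α : Type*} {l : Filter α} {a : α → PowerSeries ℂ}
    {ρ : α → ℂ} (hρ : Tendsto ρ l (𝓝 1)) (h0 : ∀ x, PowerSeries.constantCoeff (a x) = 1)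
    (h : ∀ n, (∃ L, Tendsto (fun x => PowerSeries.coeff n (a x)) l (𝓝 L)) →
      ∃ L, Tendsto (fun x => PowerSeries.coeff (n + 1) (a x * PowerSeries.rescale (ρ x) (a x))) l
        (𝓝 L)) (n : ℕ) :
    ∃ L, Tendsto (fun x => PowerSeries.coeff n (a x)) l (𝓝 L) := by
  induction n using Nat.strong_induction_on with
  | _ n ih =>
    rcases n with _ | n
    · exact ⟨1, by simp [h0, tendsto_const_nhds]⟩
    · obtain ⟨L, hL⟩ := h n (ih n (Nat.lt_succ_self n))
      choose! τ hτ using ih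
      -- The top coefficient enters linearly, with the factor 1 + ρⁿ⁺¹ → 2, so it can be solved for
      -- in terms of lower ones.
      have hsplit : ∀ x, PowerSeries.coeff (n + 1) (a x * PowerSeries.rescale (ρ x) (a x)) =
          (∑ k ∈ Finset.range n, PowerSeries.coeff (k + 1) (a x) *
            (ρ x ^ (n - k) * PowerSeries.coeff (n - k) (a x))) +
          (1 + ρ x ^ (n + 1)) * PowerSeries.coeff (n + 1) (a x) := fun x => by
        rw [PowerSeries.coeff_mul, Finset.Nat.sum_antidiagonal_eq_sum_range_succ_mk,
          Finset.sum_range_succ, Finset.sum_range_succ']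
        simp only [PowerSeries.coeff_rescale, Nat.sub_self, Nat.sub_zero, Nat.add_sub_add_right,
          PowerSeries.coeff_zero_eq_constantCoeff, h0, pow_zero]
        ring
      have hS : Tendsto (fun x => ∑ k ∈ Finset.range n, PowerSeries.coeff (k + 1) (a x) *
            (ρ x ^ (n - k) * PowerSeries.coeff (n - k) (a x))) l
          (𝓝 (∑ k ∈ Finset.range n, τ (k + 1) * (1 ^ (n - k) * τ (n - k)))) := by
        refine tendsto_finsetSum _ fun k hk => ?_
        rw [Finset.mem_range] at hk
        exact (hτ _ (by omega)).mul ((hρ.pow _).mul (hτ _ (by omega)))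
      have hD : Tendsto (fun x => 1 + ρ x ^ (n + 1)) l (𝓝 (1 + 1 ^ (n + 1))) :=
        (hρ.pow _).const_add 1
      have hD0 : (1 + 1 ^ (n + 1) : ℂ) ≠ 0 := by norm_num
      refine ⟨_, ((hL.sub hS).div hD hD0).congr' ?_⟩
      filter_upwards [hD.eventually_ne hD0] with x hx
      rw [Pi.div_apply, hsplit, add_sub_cancel_left, mul_div_cancel_left₀ _ hx]

end Limits

/-! ### Convergence of the dilated `q`-exponentials in one leg -/

section OneLeg

/-- The formal power series of the `q`-exponential `E_q(η x)`. -/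
def symExpSeries (η q : ℂ) : PowerSeries ℂ := PowerSeries.mk fun n => η ^ n * (symFactorial q n)⁻¹

theorem constantCoeff_symExpSeries (η q : ℂ) :
    PowerSeries.constantCoeff (symExpSeries η q) = 1 := by
  rw [← PowerSeries.coeff_zero_eq_constantCoeff_apply, symExpSeries, PowerSeries.coeff_mk]
  simp [symFactorial]

theorem constantCoeff_rescale (a : ℂ) (f : PowerSeries ℂ) :
    PowerSeries.constantCoeff (PowerSeries.rescale a f) = PowerSeries.constantCoeff f := by
  rw [← PowerSeries.coeff_zero_eq_constantCoeff_apply, PowerSeries.coeff_rescale]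
  simp

/-- The quotient `E_q(η a x) / E_q(η x)`. -/
def expQuotient (η q a : ℂ) : PowerSeries ℂ :=
  (symExpSeries η q)⁻¹ * PowerSeries.rescale a (symExpSeries η q)

theorem symExpSeries_mul_inv (η q : ℂ) : symExpSeries η q * (symExpSeries η q)⁻¹ = 1 :=
  PowerSeries.mul_inv_cancel _ (by rw [constantCoeff_symExpSeries]; exact one_ne_zero)

theorem constantCoeff_expQuotient (η q a : ℂ) :
    PowerSeries.constantCoeff (expQuotient η q a) = 1 := by
  have h1 := congrArg PowerSeries.constantCoeff (symExpSeries_mul_inv η q)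
  rw [map_mul, constantCoeff_symExpSeries, one_mul, map_one] at h1
  rw [expQuotient, map_mul, h1, constantCoeff_rescale, constantCoeff_symExpSeries, one_mul]

theorem expQuotient_mul_rescale (η q a b : ℂ) :
    expQuotient η q a * PowerSeries.rescale a (expQuotient η q b) = expQuotient η q (a * b) := by
  have h1 := congrArg (PowerSeries.rescale a) (symExpSeries_mul_inv η q)
  rw [map_mul, map_one] at h1
  rw [expQuotient, expQuotient, map_mul, PowerSeries.rescale_rescale, expQuotient, mul_comm b a]
  linear_combination ((symExpSeries η q)⁻¹ *
    PowerSeries.rescale (a * b) (symExpSeries η q)) * h1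

/-- The `q`-difference equation of the `q`-exponential, up to a given order. -/
theorem coeff_symExpSeries_sub {η q : ℂ} (hq : q - q⁻¹ ≠ 0) {n : ℕ}
    (hn : ∀ k < n, symNum q (k + 1) ≠ 0) :
    PowerSeries.X ^ (n + 1) ∣ PowerSeries.rescale q (symExpSeries η q) -
      PowerSeries.rescale q⁻¹ (symExpSeries η q) -
      PowerSeries.C ((q - q⁻¹) * η) * PowerSeries.X * symExpSeries η q := by
  rw [PowerSeries.X_pow_dvd_iff]
  intro m hm
  rw [mul_assoc, map_sub, map_sub, PowerSeries.coeff_rescale, PowerSeries.coeff_rescale,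
    PowerSeries.coeff_C_mul]
  rcases m with _ | m
  · simp
  -- The recursion of the coefficients needs [m+1]_q ≠ 0, which can fail at roots of unity; hence
  -- the truncation to finite order.
  · have h1 : symNum q (m + 1) ≠ 0 := hn m (by omega)
    have h2 : q ^ (m + 1) - q⁻¹ ^ (m + 1) = symNum q (m + 1) * (q - q⁻¹) := by
      rw [symNum, div_mul_cancel₀ _ hq, inv_pow]
    rw [PowerSeries.coeff_succ_X_mul, symExpSeries, PowerSeries.coeff_mk, PowerSeries.coeff_mk,
      ← sub_mul, h2, symFactorial_succ, mul_inv]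
    field_simp
    ring

/-- The Riccati equation of the quotient, up to a given order. -/
theorem coeff_expQuotient_mul_rescale {η q : ℂ} (hq0 : q ≠ 0) (hq : q - q⁻¹ ≠ 0) {n : ℕ}
    (hn : ∀ k < n + 1, symNum q (k + 1) ≠ 0) :
    PowerSeries.coeff (n + 1) (expQuotient η q q * PowerSeries.rescale q⁻¹ (expQuotient η q q)) =
      (q - q⁻¹) * η * (q⁻¹ ^ n * PowerSeries.coeff n (expQuotient η q q)) := by
  set t := expQuotient η q q with ht
  have hd := coeff_symExpSeries_sub (η := η) hq hn
  have h1 := symExpSeries_mul_inv η q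
  have h2 := congrArg (PowerSeries.rescale q⁻¹) h1
  rw [map_mul, map_one] at h2
  have h3 : PowerSeries.rescale q⁻¹ t =
      PowerSeries.rescale q⁻¹ (symExpSeries η q)⁻¹ * symExpSeries η q := by
    rw [ht, expQuotient, map_mul, PowerSeries.rescale_rescale, mul_inv_cancel₀ hq0,
      PowerSeries.rescale_one]
    rfl
  -- The `q`-difference equation E(qx) - E(x/q) = (q - q⁻¹)η x E(x), divided by E(x/q).
  have h4 : t * PowerSeries.rescale q⁻¹ t - 1 -
      PowerSeries.C ((q - q⁻¹) * η) * (PowerSeries.X * PowerSeries.rescale q⁻¹ t) =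
      PowerSeries.rescale q⁻¹ (symExpSeries η q)⁻¹ *
      (PowerSeries.rescale q (symExpSeries η q) - PowerSeries.rescale q⁻¹ (symExpSeries η q) -
      PowerSeries.C ((q - q⁻¹) * η) * PowerSeries.X * symExpSeries η q) := by
    rw [h3, ht, expQuotient]
    linear_combination (PowerSeries.rescale q (symExpSeries η q) *
      PowerSeries.rescale q⁻¹ (symExpSeries η q)⁻¹) * h1 + h2
  have h5 := (PowerSeries.X_pow_dvd_iff.1 (hd.mul_left
    (PowerSeries.rescale q⁻¹ (symExpSeries η q)⁻¹))) (n + 1) (by omega)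
  rw [← h4, map_sub, map_sub, PowerSeries.coeff_C_mul, PowerSeries.coeff_succ_X_mul,
    PowerSeries.coeff_rescale, PowerSeries.coeff_one, if_neg n.succ_ne_zero, sub_zero,
    sub_eq_zero] at h5
  exact h5

theorem tendsto_sub_inv_mul (h : ℂ) :
    Tendsto (fun q : ℂ => (q - q⁻¹) * (h / (q - 1))) (𝓝[≠] 1) (𝓝 (2 * h)) := by
  have h1 : Tendsto (fun q : ℂ => (1 + q⁻¹) * h) (𝓝[≠] 1) (𝓝 ((1 + 1⁻¹) * h)) :=
    ((tendsto_id_nhdsNE.inv₀ one_ne_zero).const_add 1).mul_const h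
  rw [inv_one, one_add_one_eq_two] at h1
  refine h1.congr' ?_
  filter_upwards [eventually_ne_zero, self_mem_nhdsWithin] with q hq hq1
  have : q - 1 ≠ 0 := sub_ne_zero.2 hq1
  field_simp
  ring

/-- The half-dilated quotient has convergent coefficients. -/
theorem exists_tendsto_coeff_expQuotient (h : ℂ) (n : ℕ) :
    ∃ L, Tendsto (fun q : ℂ => PowerSeries.coeff n
      (expQuotient (h / (q - 1)) q (Complex.exp (Complex.log q * (1 / 2))))) (𝓝[≠] 1) (𝓝 L) := by
  have hε := tendsto_sub_inv_mul h
  -- The quotient with dilation `q` comes first: its Riccati equation involves η only through (q -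
  -- q⁻¹)η, which converges.
  have ht : ∀ n, ∃ L, Tendsto (fun q : ℂ => PowerSeries.coeff n
      (expQuotient (h / (q - 1)) q q)) (𝓝[≠] 1) (𝓝 L) := by
    refine exists_tendsto_coeff_of_mul_rescale (ρ := fun q => q⁻¹) ?_
      (fun q => constantCoeff_expQuotient _ _ _) ?_
    · simpa using tendsto_id_nhdsNE.inv₀ one_ne_zero
    · rintro n ⟨L, hL⟩
      refine ⟨_, (hε.mul (((tendsto_id_nhdsNE.inv₀ one_ne_zero).pow n).mul hL)).congr' ?_⟩
      filter_upwards [eventually_ne_zero, eventually_sq_ne_one,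
        eventually_forall_symNum_ne_zero (n + 1)] with q hq hq2 hn
      exact (coeff_expQuotient_mul_rescale hq (sub_inv_ne_zero hq hq2) hn).symm
  revert n
  -- The half-dilated quotient u satisfies u(x) u(q^(1/2)x) = t(x), so its convergence follows from
  -- that of t.
  refine exists_tendsto_coeff_of_mul_rescale (tendsto_exp_log (1 / 2))
    (fun q => constantCoeff_expQuotient _ _ _) ?_
  rintro n -
  obtain ⟨L, hL⟩ := ht (n + 1)
  refine ⟨L, hL.congr' ?_⟩
  filter_upwards [eventually_ne_zero] with q hq
  rw [expQuotient_mul_rescale, ← Complex.exp_add, ← mul_add, add_halves, mul_one,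
    Complex.exp_log hq]

variable {h η q : ℂ} {N : ℕ}

theorem evalSeries_rescale (a : ℂ) : evalSeries (qJplus q N) (N + 1)
    (PowerSeries.rescale (Complex.exp (Complex.log q * a)) (symExpSeries η q)) =
      dilatedExp η q N a := by
  rw [evalSeries_eq_sum, dilatedExp]
  refine Finset.sum_congr rfl fun n _ => ?_
  rw [PowerSeries.coeff_rescale, symExpSeries, PowerSeries.coeff_mk, ← Complex.exp_nat_mul]
  congr 1
  rw [show (n : ℂ) * (Complex.log q * a) = Complex.log q * (a * n) by ring]
  ring

theorem dilatedExp_zero : dilatedExp η q N 0 = evalSeries (qJplus q N) (N + 1) (symExpSeries η q) := by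
  rw [← evalSeries_rescale, mul_zero, Complex.exp_zero, PowerSeries.rescale_one]
  rfl

theorem M_eq : M h q N = dilatedExp (h / (q - 1)) q N 0 := by
  have h1 : ((h / (q - 1)) • qJplus q N) ^ (N + 1) = 0 := by
    rw [smul_pow, (isSuperdiagonal_qJplus q N).pow_eq_zero, smul_zero]
  rw [M, symExp, tsum_smul_pow_eq_sum _ h1, dilatedExp]
  refine Finset.sum_congr rfl fun n _ => ?_
  rw [smul_pow, smul_smul, zero_mul, mul_zero, Complex.exp_zero, mul_one, mul_comm]

theorem dilatedExp_zero_mul (a : ℂ) : dilatedExp η q N 0 *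
    evalSeries (qJplus q N) (N + 1) (expQuotient η q (Complex.exp (Complex.log q * a))) =
      dilatedExp η q N a := by
  have hJ := (isSuperdiagonal_qJplus q N).pow_eq_zero
  rw [dilatedExp_zero, ← evalSeries_mul hJ, expQuotient, ← mul_assoc, symExpSeries_mul_inv, one_mul,
    evalSeries_rescale]

theorem isUnit_dilatedExp_zero : IsUnit (dilatedExp η q N 0) := by
  have hJ := (isSuperdiagonal_qJplus q N).pow_eq_zero
  refine IsUnit.of_mul_eq_one (evalSeries (qJplus q N) (N + 1) (symExpSeries η q)⁻¹) ?_
  rw [dilatedExp_zero, ← evalSeries_mul hJ, symExpSeries_mul_inv, evalSeries_one _ _ hJ]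

/-- J₊ raises the eigenvalue of J₀ by 2, so conjugation by q^(aJ₀/2) multiplies J₊ by q^a. -/
theorem dilatedExp_eq_conj (a : ℂ) : dilatedExp η q N a =
    weightPow q N (a / 2) * dilatedExp η q N 0 * weightPow q N (-(a / 2)) := by
  rw [dilatedExp, dilatedExp, Finset.mul_sum, Finset.sum_mul]
  refine Finset.sum_congr rfl fun n _ => ?_
  rw [mul_smul_comm, (isSuperdiagonal_qJplus q N).weightPow_mul_pow, smul_mul_assoc, smul_mul_assoc,
    mul_assoc (qJplus q N ^ n), weightPow_mul_neg, mul_one, smul_smul, zero_mul, mul_zero, Complex.exp_zero, mul_one,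
    mul_div_cancel₀ _ two_ne_zero, ← Complex.exp_nat_mul,
    show (n : ℂ) * (Complex.log q * a) = Complex.log q * (a * n) by ring]
  congr 1
  ring

/-- The `q`-difference equation of the `q`-exponential of `J₊`. -/
theorem dilatedExp_sub (hq : q ≠ 0) (hq' : q - q⁻¹ ≠ 0)
    (hN : ∀ n < N, symNum q (n + 1) ≠ 0) :
    dilatedExp η q N 1 - dilatedExp η q N (-1) =
      dilatedExp η q N 0 * (((q - q⁻¹) * η) • qJplus q N) := by
  have hJ := (isSuperdiagonal_qJplus q N).pow_eq_zero
  rw [dilatedExp, dilatedExp, ← Finset.sum_sub_distrib, Finset.sum_range_succ', dilatedExp,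
    Finset.sum_range_succ, add_mul, Finset.sum_mul, smul_mul_smul_comm, ← pow_succ, hJ, smul_zero,
    add_zero]
  simp only [Nat.cast_zero, mul_zero, pow_zero, Complex.exp_zero, sub_self, add_zero]
  refine Finset.sum_congr rfl fun n hn => ?_
  have hn' := hN n (Finset.mem_range.1 hn)
  have e1 : Complex.exp (Complex.log q * (1 * ((n + 1 : ℕ) : ℂ))) = q ^ (n + 1) := by
    rw [one_mul, mul_comm, Complex.exp_nat_mul, Complex.exp_log hq]
  have e2 : Complex.exp (Complex.log q * (-1 * ((n + 1 : ℕ) : ℂ))) = (q ^ (n + 1))⁻¹ := by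
    rw [neg_one_mul, mul_neg, Complex.exp_neg, mul_comm, Complex.exp_nat_mul, Complex.exp_log hq]
  have h2 : q ^ (n + 1) - (q ^ (n + 1))⁻¹ = symNum q (n + 1) * (q - q⁻¹) := by
    rw [symNum, div_mul_cancel₀ _ hq']
  rw [e1, e2, ← sub_smul, ← sub_mul, ← mul_sub, h2, smul_mul_smul_comm, ← pow_succ,
    symFactorial_succ, mul_inv, zero_mul, mul_zero, Complex.exp_zero]
  congr 1
  generalize symFactorial q n = x
  field_simp
  ring

/-- With A = V², B = S² the equation becomes (A - B)(AB + 1) = 0, and AB + 1 is 2 plus a nilpotent,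
hence invertible. Then (V - S)(V + S) = 0 is treated in the same way. -/
theorem eq_of_sq_sub_inv_sq {ι : Type*} [Fintype ι] [DecidableEq ι] {V S : Matrix ι ι ℂ}
    (hVS : Commute V S) (hV : IsNilpotent (V - 1)) (hS : IsNilpotent (S - 1))
    (h : V ^ 2 - (V ^ 2)⁻¹ = S ^ 2 - (S ^ 2)⁻¹) : V = S := by
  have hu : ∀ A : Matrix ι ι ℂ, IsNilpotent (A - 1) → IsUnit A := fun A hA => by
    simpa using hA.isUnit_one_add
  have hu2 : ∀ A : Matrix ι ι ℂ, IsNilpotent A → IsUnit ((2 : ℂ) • 1 + A) := fun A hA => by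
    have h1 : (2 : ℂ) • 1 + A = (2 : ℂ) • (1 + (2⁻¹ : ℂ) • A) := by module
    rw [h1, Matrix.isUnit_iff_isUnit_det, Matrix.det_smul]
    exact (IsUnit.mk0 _ (pow_ne_zero _ two_ne_zero)).mul
      ((Matrix.isUnit_iff_isUnit_det _).1 (hA.smul _).isUnit_one_add)
  have hmul : ∀ A B : Matrix ι ι ℂ, Commute A B → IsNilpotent (A - 1) → IsNilpotent (B - 1) →
      IsNilpotent (A * B - 1) := fun A B hAB hA hB => by
    have h1 : A * B - 1 = A * (B - 1) + (A - 1) := by noncomm_ring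
    have hc : Commute A (B - 1) := hAB.sub_right (Commute.one_right _)
    rw [h1]
    refine Commute.isNilpotent_add ?_ (hc.isNilpotent_mul_left hB) hA
    exact ((Commute.refl A).mul_left hc.symm).sub_right (Commute.one_right _)
  have hV2 : IsNilpotent (V ^ 2 - 1) := by rw [sq]; exact hmul V V (Commute.refl V) hV hV
  have hS2 : IsNilpotent (S ^ 2 - 1) := by rw [sq]; exact hmul S S (Commute.refl S) hS hS
  have hAB : Commute (V ^ 2) (S ^ 2) := hVS.pow_pow 2 2
  have hsq : V ^ 2 = S ^ 2 := by
    have hA := Matrix.mul_nonsing_inv _ ((Matrix.isUnit_iff_isUnit_det _).1 (hu _ hV2))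
    have hB := Matrix.nonsing_inv_mul _ ((Matrix.isUnit_iff_isUnit_det _).1 (hu _ hS2))
    have hABn := hmul _ _ hAB hV2 hS2
    generalize V ^ 2 = A at *
    generalize S ^ 2 = B at *
    have h2 : A * A * B - B = A * B * B - A := by
      have := congrArg (fun C => A * C * B) h
      simp only [mul_sub, sub_mul, hA, one_mul] at this
      rwa [mul_assoc A B⁻¹, hB, mul_one] at this
    have h3 : (A - B) * ((2 : ℂ) • 1 + (A * B - 1)) = 0 := by
      have : (2 : ℂ) • 1 + (A * B - 1) = A * B + 1 := by module
      rw [this, sub_mul, mul_add, mul_add, ← mul_assoc, ← mul_assoc, ← hAB.eq, mul_one, mul_one]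
      have h5 := sub_eq_zero.2 h2
      rw [← h5]
      abel
    exact sub_eq_zero.1 ((hu2 _ hABn).mul_left_eq_zero.1 h3)
  have hn : IsNilpotent ((V - 1) + (S - 1)) :=
    ((hVS.sub_left (Commute.one_left S)).sub_right (Commute.one_right _)).isNilpotent_add hV hS
  have h4 : (V - S) * ((2 : ℂ) • 1 + ((V - 1) + (S - 1))) = 0 := by
    have : (2 : ℂ) • 1 + ((V - 1) + (S - 1)) = V + S := by module
    rw [this, sub_mul, mul_add, mul_add, ← sq, ← sq, hsq, hVS.eq]
    abel
  exact sub_eq_zero.1 ((hu2 _ hn).mul_left_eq_zero.1 h4)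

/-- The conjugated Cartan element `M⁻¹ q ^ (J₀ / 4) M`. -/
def conjWeight (h q : ℂ) (N : ℕ) : Matrix (Fin (N + 1)) (Fin (N + 1)) ℂ :=
  (M h q N)⁻¹ * weightPow q N (1 / 4) * M h q N

theorem isUnit_M : IsUnit (M h q N) := by
  rw [M_eq]; exact isUnit_dilatedExp_zero

theorem M_mul_inv : M h q N * (M h q N)⁻¹ = 1 :=
  Matrix.mul_nonsing_inv _ ((Matrix.isUnit_iff_isUnit_det _).1 isUnit_M)

theorem M_inv_mul : (M h q N)⁻¹ * M h q N = 1 :=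
  Matrix.nonsing_inv_mul _ ((Matrix.isUnit_iff_isUnit_det _).1 isUnit_M)

theorem weightPow_nat (a : ℂ) (n : ℕ) : weightPow q N (n * a) = weightPow q N a ^ n := by
  induction n with
  | zero => simp [weightPow_zero]
  | succ n ih =>
    rw [pow_succ, ← ih, ← weightPow_add]
    congr 1
    push_cast
    ring

theorem conjWeight_pow (n : ℕ) : conjWeight h q N ^ n =
    (M h q N)⁻¹ * weightPow q N (n / 4) * M h q N := by
  have h1 : (n / 4 : ℂ) = n * (1 / 4) := by ring
  rw [h1, weightPow_nat]
  induction n with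
  | zero => simp [M_inv_mul]
  | succ n ih =>
    have h2 : weightPow q N (1 / 4) ^ (n + 1) =
        weightPow q N (1 / 4) ^ n * (M h q N * (M h q N)⁻¹) * weightPow q N (1 / 4) := by
      rw [M_mul_inv, mul_one, pow_succ]
    rw [pow_succ, ih (by ring), h2, conjWeight]
    simp only [mul_assoc]

theorem M_inv_mul_dilatedExp (a : ℂ) : (M h q N)⁻¹ * dilatedExp (h / (q - 1)) q N a =
    (M h q N)⁻¹ * weightPow q N (a / 2) * M h q N * weightPow q N (-(a / 2)) := by
  rw [dilatedExp_eq_conj, ← M_eq]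
  simp only [mul_assoc]

/-- The eigenvalues of J₀ are integers, so only dilations by integer powers of q^(1/2) occur; the
single matrix `conjWeight` controls them all. -/
theorem M_inv_mul_dilatedExp_nat (n : ℕ) : (M h q N)⁻¹ * dilatedExp (h / (q - 1)) q N (n / 2) =
    conjWeight h q N ^ n * weightPow q N (-(n / 4)) := by
  rw [M_inv_mul_dilatedExp, conjWeight_pow]
  ring_nf

theorem M_inv_mul_dilatedExp_neg (n : ℕ) :
    (M h q N)⁻¹ * dilatedExp (h / (q - 1)) q N (-(n / 2)) =
      (conjWeight h q N ^ n)⁻¹ * weightPow q N (n / 4) := by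
  have h1 : (conjWeight h q N ^ n)⁻¹ = (M h q N)⁻¹ * weightPow q N (-(n / 4)) * M h q N := by
    refine Matrix.inv_eq_right_inv ?_
    have h2 : weightPow q N (n / 4) * (M h q N * (M h q N)⁻¹) * weightPow q N (-(n / 4)) = 1 := by
      rw [M_mul_inv, mul_one, weightPow_mul_neg]
    calc _ = (M h q N)⁻¹ * (weightPow q N (n / 4) * (M h q N * (M h q N)⁻¹) *
          weightPow q N (-(n / 4))) * M h q N := by
          rw [conjWeight_pow]; simp only [mul_assoc]
      _ = 1 := by rw [h2, mul_one, M_inv_mul]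
  rw [h1, M_inv_mul_dilatedExp]
  ring_nf

/-- Convergence comes from the coefficients of the half-dilated quotient. The limit V is then
identified through the `q`-difference equation, which becomes V² - V⁻² = 2hJ₊ and is also solved by
T^(1/2). -/
theorem tendsto_conjWeight (h : ℂ) (N : ℕ) :
    Tendsto (fun q => conjWeight h q N) (𝓝[≠] 1) (𝓝 (Tpow h N (1 / 2))) := by
  choose τ hτ using exists_tendsto_coeff_expQuotient h
  set V := evalSeries (Jplus N) (N + 1) (PowerSeries.mk τ) with hV
  have hJ := (isSuperdiagonal_Jplus N).pow_eq_zero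
  have hτ0 : τ 0 = 1 := by
    have h1 := hτ 0
    simp only [PowerSeries.coeff_zero_eq_constantCoeff, constantCoeff_expQuotient] at h1
    exact tendsto_nhds_unique h1 tendsto_const_nhds
  have hlim : Tendsto (fun q => conjWeight h q N) (𝓝[≠] 1) (𝓝 V) := by
    have h1 : Tendsto (fun q => evalSeries (qJplus q N) (N + 1) (expQuotient (h / (q - 1)) q
        (Complex.exp (Complex.log q * (1 / 2)))) * weightPow q N (1 / 4)) (𝓝[≠] 1) (𝓝 (V * 1)) := by
      refine Tendsto.mul ?_ (tendsto_weightPow N _)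
      simp only [hV, evalSeries_eq_sum, PowerSeries.coeff_mk]
      exact tendsto_finsetSum _ fun n _ => (hτ n).smul ((tendsto_qJplus N).pow n)
    rw [mul_one] at h1
    refine h1.congr fun q => ?_
    have h2 := M_inv_mul_dilatedExp_nat (h := h) (q := q) (N := N) 1
    have h3 := dilatedExp_zero_mul (η := h / (q - 1)) (q := q) (N := N) (1 / 2)
    rw [← M_eq] at h3
    rw [Nat.cast_one, pow_one, ← h3, ← mul_assoc, M_inv_mul, one_mul] at h2
    rw [h2, mul_assoc, ← weightPow_add, neg_add_cancel, weightPow_zero, mul_one]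
  have hVn : IsNilpotent (V - 1) := by
    have := isNilpotent_evalSeries_sub hJ (PowerSeries.mk τ)
    rwa [← PowerSeries.coeff_zero_eq_constantCoeff_apply, PowerSeries.coeff_mk, hτ0, one_smul] at this
  have hVT : Commute V (Tpow h N (1 / 2)) := by
    refine commute_Tpow_of_commute ?_ _
    rw [hV, evalSeries_eq_sum]
    exact Commute.sum_left _ _ _ fun k _ => (commute_Jplus_X.pow_left k).smul_left _
  have hV2 : IsUnit (V ^ 2) := by
    have : IsUnit V := by simpa using hVn.isUnit_one_add
    exact this.pow 2
  have heq : V ^ 2 - (V ^ 2)⁻¹ = (2 * h) • Jplus N := by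
    have h1 : Tendsto (fun q => conjWeight h q N ^ 2 * weightPow q N (-(2 / 4)) -
        (conjWeight h q N ^ 2)⁻¹ * weightPow q N (2 / 4)) (𝓝[≠] 1)
        (𝓝 (V ^ 2 * 1 - (V ^ 2)⁻¹ * 1)) :=
      ((hlim.pow 2).mul (tendsto_weightPow N _)).sub
        ((tendsto_matrix_inv (hlim.pow 2) hV2).mul (tendsto_weightPow N _))
    rw [mul_one, mul_one] at h1
    refine tendsto_nhds_unique h1 (((tendsto_sub_inv_mul h).smul (tendsto_qJplus N)).congr' ?_)
    filter_upwards [eventually_ne_zero, eventually_sq_ne_one,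
      eventually_forall_symNum_ne_zero N] with q hq hq2 hn
    have h2 := M_inv_mul_dilatedExp_nat (h := h) (q := q) (N := N) 2
    have h3 := M_inv_mul_dilatedExp_neg (h := h) (q := q) (N := N) 2
    have h4 := dilatedExp_sub (η := h / (q - 1)) hq (sub_inv_ne_zero hq hq2) hn
    rw [← M_eq] at h4
    push_cast at h2 h3
    rw [div_self two_ne_zero] at h2 h3
    rw [← h2, ← h3, ← mul_sub, h4, ← mul_assoc, M_inv_mul, one_mul]
  have hT2 : Tpow h N (1 / 2) ^ 2 = Tpow h N 1 := by
    rw [sq, ← Tpow_add, add_halves]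
  have hTi : (Tpow h N 1)⁻¹ = Tpow h N (-1) := Matrix.inv_eq_right_inv (Tpow_mul_Tpow_neg 1)
  have : V = Tpow h N (1 / 2) := by
    refine eq_of_sq_sub_inv_sq hVT hVn (isNilpotent_Tpow_sub_one _) ?_
    rw [heq, hT2, hTi, Tpow_one_eq, Tpow_neg_one_eq]
    module
  rwa [this] at hlim

theorem Tpow_nat (a : ℂ) (n : ℕ) : Tpow h N a ^ n = Tpow h N (n * a) := by
  induction n with
  | zero => simp [Tpow_zero]
  | succ n ih =>
    rw [pow_succ, ih, ← Tpow_add]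
    congr 1
    push_cast
    ring

theorem tendsto_M_inv_mul_dilatedExp (h : ℂ) (N : ℕ) (w : ℤ) :
    Tendsto (fun q => (M h q N)⁻¹ * dilatedExp (h / (q - 1)) q N (w / 2)) (𝓝[≠] 1)
      (𝓝 (Tpow h N (w / 2))) := by
  obtain ⟨n, rfl | rfl⟩ := w.eq_nat_or_neg
  · have h1 := ((tendsto_conjWeight h N).pow n).mul (tendsto_weightPow N (-(n / 4)))
    rw [mul_one, Tpow_nat] at h1
    simp only [Int.cast_natCast, M_inv_mul_dilatedExp_nat]
    convert h1 using 2
    ring_nf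
  · have hu : IsUnit (Tpow h N (1 / 2) ^ n) := (Matrix.isUnit_exp _).pow n
    have h1 := (tendsto_matrix_inv ((tendsto_conjWeight h N).pow n) hu).mul
      (tendsto_weightPow N (n / 4))
    have hi : (Tpow h N (n * (1 / 2)))⁻¹ = Tpow h N (-(n * (1 / 2))) :=
      Matrix.inv_eq_right_inv (Tpow_mul_Tpow_neg _)
    rw [mul_one, Tpow_nat, hi] at h1
    simp only [Int.cast_neg, Int.cast_natCast, neg_div, M_inv_mul_dilatedExp_neg]
    convert h1 using 2
    ring_nf

end OneLeg

/-! ### The contraction limit -/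

section Contraction

variable {N₁ N₂ : ℕ}

/-- The factor 1 - q⁻² kills the exponent, as the generators stay bounded; all singularities of the
conjugated matrix come from `M`. -/
theorem tendsto_Rq (N₁ N₂ : ℕ) : Tendsto (fun q => Rq q N₁ N₂) (𝓝[≠] 1) (𝓝 1) := by
  choose L hL using tendsto_asymFactorial_inv
  have hL0 : L 0 = 1 := by
    have h1 := hL 0
    simp only [asymFactorial, Finset.range_zero, Finset.prod_empty, inv_one] at h1
    exact tendsto_nhds_unique h1 tendsto_const_nhds
  have hJ : Tendsto (fun q => qJplus q N₁) (𝓝[≠] 1) (𝓝 (Jplus N₁)) := tendsto_qJplus N₁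
  have hU : Tendsto (fun q => rExponent q N₁ N₂) (𝓝[≠] 1) (𝓝 0) := by
    have h1 : Tendsto (fun q : ℂ => 1 - (q ^ 2)⁻¹) (𝓝[≠] 1) (𝓝 (1 - (1 ^ 2)⁻¹)) :=
      ((tendsto_id_nhdsNE.pow 2).inv₀ (by simp)).const_sub 1
    have h2 : Tendsto (fun q : ℂ => (weightPow q N₁ (1 / 2) * qJplus q N₁) ⊗ₖ
        (weightPow q N₂ (-1 / 2) * Jminus N₂)) (𝓝[≠] 1) (𝓝 ((1 * Jplus N₁) ⊗ₖ (1 * Jminus N₂))) := by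
      have h3 := (tendsto_weightPow N₁ (1 / 2)).mul hJ
      have h4 := (tendsto_weightPow N₂ (-1 / 2)).mul_const (Jminus N₂)
      refine tendsto_pi_nhds.2 fun r => tendsto_pi_nhds.2 fun c => ?_
      exact (tendsto_pi_nhds.1 (tendsto_pi_nhds.1 h3 r.1) c.1).mul
        (tendsto_pi_nhds.1 (tendsto_pi_nhds.1 h4 r.2) c.2)
    have h5 := h1.smul h2
    rwa [one_pow, inv_one, sub_self, zero_smul] at h5
  have hE : Tendsto (fun q : ℂ => asymExp ((q ^ 2)⁻¹) (rExponent q N₁ N₂)) (𝓝[≠] 1) (𝓝 1) := by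
    have h1 : Tendsto (fun q : ℂ => ∑ n ∈ Finset.range (N₁ + 1),
        (asymFactorial ((q ^ 2)⁻¹) n)⁻¹ • rExponent q N₁ N₂ ^ n) (𝓝[≠] 1)
        (𝓝 (∑ n ∈ Finset.range (N₁ + 1), L n • 0 ^ n)) :=
      tendsto_finsetSum _ fun n _ => (hL n).smul (hU.pow n)
    rw [Finset.sum_range_succ'] at h1
    simp only [zero_pow (Nat.succ_ne_zero _), smul_zero, Finset.sum_const_zero, zero_add, pow_zero,
      hL0, one_smul] at h1
    exact h1.congr fun q => (tsum_smul_pow_eq_sum _ rExponent_pow).symm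
  have hK : Tendsto (fun q => rCartan q N₁ N₂) (𝓝[≠] 1) (𝓝 1) := tendsto_diagonal_exp_log _
  have := hK.mul hE
  rw [mul_one] at this
  exact this.congr fun q => Rq_eq.symm

/-- The `q`-deformed twist `(M ⊗ M)⁻¹ Δ(M)`. -/
def qTwist (h q : ℂ) (N₁ N₂ : ℕ) (s : ℂ) :
    Matrix (Fin (N₁ + 1) × Fin (N₂ + 1)) (Fin (N₁ + 1) × Fin (N₂ + 1)) ℂ :=
  ((M h q N₁)⁻¹ ⊗ₖ (M h q N₂)⁻¹) * ∑ n ∈ Finset.range ((N₁ + 1) + (N₂ + 1)),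
    (h / (q - 1)) ^ n • coproductDivPow q N₁ N₂ s n

theorem tendsto_qTwist (h : ℂ) (N₁ N₂ : ℕ) (s : ℤ) :
    Tendsto (fun q => qTwist h q N₁ N₂ s) (𝓝[≠] 1) (𝓝 (jordanTwist h N₁ N₂ s)) := by
  simp only [qTwist, sum_coproductDivPow, kronecker_mul_colTwist]
  refine tendsto_colTwist (fun j => ?_) (fun i => ?_)
  · have := tendsto_M_inv_mul_dilatedExp h N₁ (s * (N₂ - 2 * (j : ℕ)))
    push_cast at this
    exact this
  · have := tendsto_M_inv_mul_dilatedExp h N₂ (-(s * (N₁ - 2 * (i : ℕ))))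
    push_cast at this
    exact this

theorem conj_Rq_mul_qTwist {h q : ℂ} (hq : q ≠ 0) (hq2 : q ^ 2 ≠ 1)
    (hs : ∀ n < N₁ + 1 + (N₂ + 1), symNum q (n + 1) ≠ 0)
    (ha : ∀ n < N₁ + 1, asymNum ((q ^ 2)⁻¹) (n + 1) ≠ 0) :
    ((M h q N₁)⁻¹ ⊗ₖ (M h q N₂)⁻¹) * Rq q N₁ N₂ * (M h q N₁ ⊗ₖ M h q N₂) * qTwist h q N₁ N₂ 1 =
      qTwist h q N₁ N₂ (-1) * Rq q N₁ N₂ := by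
  have h1 : (M h q N₁ ⊗ₖ M h q N₂) * ((M h q N₁)⁻¹ ⊗ₖ (M h q N₂)⁻¹) = 1 := by
    rw [← Matrix.mul_kronecker_mul, M_mul_inv, M_mul_inv, Matrix.one_kronecker_one]
  have h2 : Rq q N₁ N₂ * ∑ n ∈ Finset.range ((N₁ + 1) + (N₂ + 1)),
      (h / (q - 1)) ^ n • coproductDivPow q N₁ N₂ 1 n =
      (∑ n ∈ Finset.range ((N₁ + 1) + (N₂ + 1)),
        (h / (q - 1)) ^ n • coproductDivPow q N₁ N₂ (-1) n) * Rq q N₁ N₂ := by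
    rw [Finset.mul_sum, Finset.sum_mul]
    refine Finset.sum_congr rfl fun n hn => ?_
    rw [mul_smul_comm, mul_coproductDivPow_of_intertwine hq (Rq_mul_coproduct hq hq2 ha)
      (fun k hk => hs k (hk.trans (Finset.mem_range.1 hn))), smul_mul_assoc]
  rw [qTwist, qTwist, mul_assoc, ← mul_assoc (M h q N₁ ⊗ₖ M h q N₂), h1, one_mul, mul_assoc, h2,
    mul_assoc]

theorem tendsto_conj_Rq (h : ℂ) (N₁ N₂ : ℕ) :
    Tendsto (fun q : ℂ => ((M h q N₁)⁻¹ ⊗ₖ (M h q N₂)⁻¹) * Rq q N₁ N₂ * (M h q N₁ ⊗ₖ M h q N₂))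
      (𝓝[≠] 1) (𝓝 (Rh h N₁ N₂)) := by
  have h1 := tendsto_qTwist h N₁ N₂ 1
  have h2 := tendsto_qTwist h N₁ N₂ (-1)
  push_cast at h1 h2
  have hu := (Matrix.isUnit_iff_isUnit_det _).1 (isUnit_jordanTwist (h := h) (N₁ := N₁) (N₂ := N₂) 1)
  have h3 := (h2.mul (tendsto_Rq N₁ N₂)).mul (tendsto_matrix_inv h1 (isUnit_jordanTwist 1))
  -- The limit is the twist for s = -1 times the inverse of the twist for s = 1, which is `Rh`.
  rw [mul_one, ← Rh_mul_jordanTwist, mul_assoc, Matrix.mul_nonsing_inv _ hu, mul_one] at h3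
  refine h3.congr' ?_
  have hdet : ∀ᶠ q in 𝓝[≠] 1, (qTwist h q N₁ N₂ 1).det ≠ 0 :=
    ((continuous_id.matrix_det.tendsto _).comp h1).eventually_ne hu.ne_zero
  filter_upwards [eventually_ne_zero, eventually_sq_ne_one, hdet,
    eventually_forall_symNum_ne_zero (N₁ + 1 + (N₂ + 1)),
    eventually_forall_asymNum_ne_zero (N₁ + 1)] with q hq hq2 hd hs ha
  rw [← conj_Rq_mul_qTwist hq hq2 hs ha, mul_assoc _ (qTwist h q N₁ N₂ 1),
    Matrix.mul_nonsing_inv _ (isUnit_iff_ne_zero.2 hd), mul_one]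

end Contraction

end Contraction

end

/-- For all spins `j₁ = N₁ / 2`, `j₂ = N₂ / 2` and every `h`, the conjugated standard `R` matrix has
a finite, invertible limit as `q → 1`, `q ≠ 1`, namely the Jordanian `R` matrix evaluated through
the nonlinear map, in which `T = exp (h X)` is indeed `T̃`. -/
theorem mainTheorem1 (N₁ N₂ : ℕ) (h : ℂ) :
    (Contraction.T h N₁ = Contraction.Ttilde h N₁ ∧
      Contraction.T h N₂ = Contraction.Ttilde h N₂) ∧
    IsUnit (Contraction.Rh h N₁ N₂) ∧
    Tendsto
      (fun q : ℂ =>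
        ((Contraction.M h q N₁)⁻¹ ⊗ₖ (Contraction.M h q N₂)⁻¹) *
          Contraction.Rq q N₁ N₂ *
          (Contraction.M h q N₁ ⊗ₖ Contraction.M h q N₂))
      (𝓝[≠] 1) (𝓝 (Contraction.Rh h N₁ N₂)) :=
  ⟨⟨Contraction.T_eq_Ttilde, Contraction.T_eq_Ttilde⟩, Contraction.isUnit_Rh,
    Contraction.tendsto_conj_Rq h N₁ N₂⟩
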